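/- Let $p_-,p_+,\Omega>0$, and let $p(x)=p_-$ for $x\le 0$ and $p(x)=p_+$ for $x>0$. Let $A_p f=-(pf')'$ be the (self-adjoint) maximal operator on $L^2(\mathbb R)$, with domain $\{f\in L^2(\mathbb R): f,\,pf'\in AC_{\mathrm{loc}}(\mathbb R),\ (pf')'\in L^2(\mathbb R)\}$, and let $PW_{[0,\Omega]}(A_p)$ be the range of its spectral projection $\mathbf 1_{[0,\Omega]}(A_p)$. Write $\operatorname{sinc}t=\sin t/t$ with $\operatorname{sinc}0=1$. Every element of $PW_{[0,\Omega]}(A_p)$ has a continuous representative, and with these representatives $PW_{[0,\Omega]}(A_p)$ is a reproducing kernel Hilbert space, whose kernel is $$k(x,y)=\begin{cases} \frac{\Omega^{1/2}}{\pi\sqrt{p_-}}\operatorname{sinc}\!\big(\Omega^{1/2}\tfrac{x-y}{\sqrt{p_-}}\big)-\frac{\sqrt{p_+}-\sqrt{p_-}}{\sqrt{p_+}+\sqrt{p_-}}\,\frac{\Omega^{1/2}}{\pi\sqrt{p_-}}\operatorname{sinc}\!\big(\Omega^{1/2}\tfrac{x+y}{\sqrt{p_-}}\big), & x,y\le 0,\\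 \frac{\Omega^{1/2}}{\pi\sqrt{p_+}}\operatorname{sinc}\!\big(\Omega^{1/2}\tfrac{x-y}{\sqrt{p_+}}\big)+\frac{\sqrt{p_+}-\sqrt{p_-}}{\sqrt{p_+}+\sqrt{p_-}}\,\frac{\Omega^{1/2}}{\pi\sqrt{p_+}}\operatorname{sinc}\!\big(\Omega^{1/2}\tfrac{x+y}{\sqrt{p_+}}\big), & x,y>0,\\ \frac{2\Omega^{1/2}}{\pi(\sqrt{p_+}+\sqrt{p_-})}\operatorname{sinc}\!\big(\Omega^{1/2}(\tfrac{x}{\sqrt{p_-}}-\tfrac{y}{\sqrt{p_+}})\big), & x\le 0<y,\\ \frac{2\Omega^{1/2}}{\pi(\sqrt{p_+}+\sqrt{p_-})}\operatorname{sinc}\!\big(\Omega^{1/2}(\tfrac{x}{\sqrt{p_+}}-\tfrac{y}{\sqrt{p_-}})\big), & y\le 0<x. \end{cases}$$ For $j\in\mathbb Z$ let $x_j=\dfrac{\pi j\sqrt{p(j)}}{\Omega^{1/2}}$, and let $w_j=\sqrt{p_-}$ for $j<0$, $w_j=\sqrt{p_+}$ for $j>0$, and $w_0=\tfrac12(\sqrt{p_+}+\sqrt{p_-})$.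 Then $\Big\{\sqrt{\tfrac{\pi w_j}{\Omega^{1/2}}}\,k(x_j,\cdot): j\in\mathbb Z\Big\}$ is an orthonormal basis of $PW_{[0,\Omega]}(A_p)$, and for every $f\in PW_{[0,\Omega]}(A_p)$ (continuous representative) the expansion $$f(x)=\frac{\pi}{\Omega^{1/2}}\sum_{j\in\mathbb Z}w_j\,f(x_j)\,k(x_j,x)$$ converges unconditionally in $L^2(\mathbb R)$ and uniformly on $\mathbb R$. -/

import Mathlib

open MeasureTheory Set Filter Topology
open scoped ENNReal

/-! ### Projection-valued measures and spectral projections of unbounded operators -/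

/-- A projection-valued (spectral) measure on the Borel sets of `ℝ`, acting on `H`: its values are
orthogonal projections, it is multiplicative on intersections, normalised, and countably additive in
the strong operator topology. As with Mathlib's vector measures, it is `0` on non-measurable sets. -/
structure ProjValuedMeasure (H : Type*) [NormedAddCommGroup H] [InnerProductSpace ℂ H]
    [CompleteSpace H] where
  proj : Set ℝ → H →L[ℂ] H
  isStarProjection : ∀ s, IsStarProjection (proj s)
  not_measurable : ∀ s, ¬ MeasurableSet s → proj s = 0
  proj_univ : proj univ = 1
  proj_inter : ∀ s t, MeasurableSet s → MeasurableSet t → proj (s ∩ t) = proj s * proj t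
  hasSum_iUnion : ∀ s : ℕ → Set ℝ, (∀ n, MeasurableSet (s n)) → Pairwise (Function.onFun Disjoint s) →
    ∀ f : H, HasSum (fun n => proj (s n) f) (proj (⋃ n, s n) f)

namespace ProjValuedMeasure

variable {H : Type*} [NormedAddCommGroup H] [InnerProductSpace ℂ H] [CompleteSpace H]

theorem inner_proj (E : ProjValuedMeasure H) (s : Set ℝ) (f : H) :
    inner ℂ f (E.proj s f) = ((‖E.proj s f‖ ^ 2 : ℝ) : ℂ) := by
  have h := E.isStarProjection s
  have h1 : E.proj s (E.proj s f) = E.proj s f :=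
    congrArg (fun T : H →L[ℂ] H => T f) h.isIdempotentElem
  have h2 : ContinuousLinearMap.adjoint (E.proj s) = E.proj s := h.isSelfAdjoint
  calc inner ℂ f (E.proj s f) = inner ℂ f (E.proj s (E.proj s f)) := by rw [h1]
    _ = inner ℂ (ContinuousLinearMap.adjoint (E.proj s) f) (E.proj s f) := by
        rw [ContinuousLinearMap.adjoint_inner_left]
    _ = inner ℂ (E.proj s f) (E.proj s f) := by rw [h2]
    _ = _ := by rw [inner_self_eq_norm_sq_to_K]; norm_cast

/-- The scalar spectral measure `s ↦ ⟨f, E(s) f⟩ = ‖E(s) f‖²` of a vector `f`. -/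
noncomputable def scalarMeasure (E : ProjValuedMeasure H) (f : H) : Measure ℝ :=
  Measure.ofMeasurable (fun s _ => ENNReal.ofReal (‖E.proj s f‖ ^ 2))
    (by
      have h := E.hasSum_iUnion (fun _ => ∅) (fun _ => MeasurableSet.empty)
        (fun _ _ _ => disjoint_bot_left) f
      have h0 : E.proj ∅ f = 0 := tendsto_nhds_unique tendsto_const_nhds h.summable.tendsto_atTop_zero
      simp [h0])
    (by
      intro s hs hd
      have h := (innerSL ℂ f).hasSum (E.hasSum_iUnion s hs hd f)
      simp only [innerSL_apply_apply, inner_proj] at h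
      have h' : HasSum (fun n => ‖E.proj (s n) f‖ ^ 2) (‖E.proj (⋃ n, s n) f‖ ^ 2) :=
        Complex.hasSum_ofReal.mp h
      rw [← h'.tsum_eq]
      exact ENNReal.ofReal_tsum_of_nonneg (fun _ => by positivity) h'.summable)

end ProjValuedMeasure

/-- `E` is the spectral measure of the operator `A`, i.e. `A = ∫ λ dE(λ)`: the domain of `A` is the
set of `f` with `∫ λ² d⟨f, E f⟩ < ∞`, and `⟨f, A f⟩ = ∫ λ d⟨f, E f⟩` on it. -/
structure IsSpectralMeasure {H : Type*} [NormedAddCommGroup H] [InnerProductSpace ℂ H]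
    [CompleteSpace H] (A : H →ₗ.[ℂ] H) (E : ProjValuedMeasure H) : Prop where
  mem_domain_iff : ∀ f : H,
    f ∈ A.domain ↔ ∫⁻ t, ENNReal.ofReal (t ^ 2) ∂(E.scalarMeasure f) < ∞
  inner_apply : ∀ f : A.domain,
    inner ℂ (f : H) (A f) = ((∫ t, t ∂(E.scalarMeasure (f : H)) : ℝ) : ℂ)

open Classical in
/-- The spectral projection `c_s(A)` of a self-adjoint operator `A`, taken from its (unique) spectral
measure; `0` if `A` has no spectral measure, i.e. is not self-adjoint. -/
noncomputable def spectralProjection {H : Type*} [NormedAddCommGroup H] [InnerProductSpace ℂ H]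
    [CompleteSpace H] (A : H →ₗ.[ℂ] H) (s : Set ℝ) : H →L[ℂ] H :=
  if h : ∃ E : ProjValuedMeasure H, IsSpectralMeasure A E then h.choose.proj s else 0

/-- The abstract Paley–Wiener space `PW_s(A)`: the range of the spectral projection `c_s(A)`. -/
noncomputable def paleyWiener {H : Type*} [NormedAddCommGroup H] [InnerProductSpace ℂ H]
    [CompleteSpace H] (A : H →ₗ.[ℂ] H) (s : Set ℝ) : Submodule ℂ H :=
  LinearMap.range (spectralProjection A s : H →ₗ[ℂ] H)

/-! ### The maximal operator `A_p f = -(p f')'` on `L²(ℝ)` -/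

/-- Complex-valued `L²(ℝ)` with respect to Lebesgue measure. -/
abbrev L2R : Type := Lp ℂ 2 (volume : Measure ℝ)

/-- Local absolute continuity on `ℝ`. -/
def LocallyAC (u : ℝ → ℂ) : Prop := ∀ a b : ℝ, AbsolutelyContinuousOnInterval u a b

theorem LocallyAC.continuous {u : ℝ → ℂ} (hu : LocallyAC u) : Continuous u := by
  rw [continuous_iff_continuousAt]
  intro x
  refine (hu (x - 1) (x + 1)).continuousOn.continuousAt ?_
  rw [uIcc_of_le (by linarith)]
  exact Icc_mem_nhds (by linarith) (by linarith)

theorem LocallyAC.ae_differentiableAt {u : ℝ → ℂ} (hu : LocallyAC u) :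
    ∀ᵐ x, DifferentiableAt ℝ u x := by
  have h : ∀ n : ℕ, ∀ᵐ x, x ∈ uIcc (-(n : ℝ)) n → DifferentiableAt ℝ u x :=
    fun n => (hu _ _).boundedVariationOn.ae_differentiableAt_of_mem_uIcc
  filter_upwards [ae_all_iff.mpr h] with x hx
  obtain ⟨n, hn⟩ := exists_nat_ge |x|
  refine hx n ?_
  rw [uIcc_of_le (by linarith [abs_nonneg x])]
  exact abs_le.mp hn

theorem LocallyAC.add {u v : ℝ → ℂ} (hu : LocallyAC u) (hv : LocallyAC v) : LocallyAC (u + v) :=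
  fun a b => (hu a b).add (hv a b)

theorem LocallyAC.const_smul {u : ℝ → ℂ} (c : ℂ) (hu : LocallyAC u) : LocallyAC (c • u) :=
  fun a b => (hu a b).const_smul c

/-- The graph of the maximal operator `A_p`: pairs `(f, -(p f')')` where `f` and `p f'` are locally
absolutely continuous (`u` and `v` below are these representatives), and `f`, `(p f')'` are in `L²`. -/
def sturmLiouvilleGraph (p : ℝ → ℝ) : Submodule ℂ (L2R × L2R) where
  carrier := {w | ∃ u v : ℝ → ℂ, LocallyAC u ∧ LocallyAC v ∧
    (w.1 : ℝ → ℂ) =ᵐ[volume] u ∧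
    (∀ᵐ x, v x = (p x : ℂ) * deriv u x) ∧
    (∀ᵐ x, (w.2 : ℝ → ℂ) x = - deriv v x)}
  zero_mem' := by
    have h0 : LocallyAC (fun _ => 0) := fun a b =>
      (LipschitzWith.const (0 : ℂ)).lipschitzOnWith.absolutelyContinuousOnInterval
    refine ⟨fun _ => 0, fun _ => 0, h0, h0, Lp.coeFn_zero _ _ _, by simp, ?_⟩
    filter_upwards [Lp.coeFn_zero ℂ 2 (volume : Measure ℝ)] with x hx
    simp_all
  add_mem' := by
    rintro a b ⟨u, v, hu, hv, h1, h2, h3⟩ ⟨u', v', hu', hv', h1', h2', h3'⟩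
    refine ⟨u + u', v + v', hu.add hu', hv.add hv', ?_, ?_, ?_⟩
    · exact (Lp.coeFn_add a.1 b.1).trans (h1.add h1')
    · filter_upwards [h2, h2', hu.ae_differentiableAt, hu'.ae_differentiableAt] with x k k' d d'
      rw [Pi.add_apply, deriv_add d d', k, k', mul_add]
    · filter_upwards [h3, h3', hv.ae_differentiableAt, hv'.ae_differentiableAt,
        Lp.coeFn_add a.2 b.2] with x k k' d d' e
      rw [deriv_add d d', neg_add, ← k, ← k']
      exact e
  smul_mem' := by
    rintro c a ⟨u, v, hu, hv, h1, h2, h3⟩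
    refine ⟨c • u, c • v, hu.const_smul c, hv.const_smul c, ?_, ?_, ?_⟩
    · exact (Lp.coeFn_smul c a.1).trans (h1.const_smul c)
    · filter_upwards [h2, hu.ae_differentiableAt] with x k d
      rw [Pi.smul_apply, deriv_const_smul c d, k, smul_eq_mul, smul_eq_mul]
      ring
    · filter_upwards [h3, hv.ae_differentiableAt, Lp.coeFn_smul c a.2] with x k d e
      rw [deriv_const_smul c d, ← smul_neg, ← k]
      exact e

theorem sturmLiouvilleGraph_single_valued (p : ℝ → ℝ) (w : L2R × L2R)
    (hw : w ∈ sturmLiouvilleGraph p) (h0 : w.1 = 0) : w.2 = 0 := by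
  obtain ⟨u, v, hu, hv, h1, h2, h3⟩ := hw
  have hu0 : u = fun _ => 0 := by
    refine Measure.eq_of_ae_eq (μ := volume) ?_ hu.continuous continuous_const
    refine h1.symm.trans ?_
    rw [h0]
    exact Lp.coeFn_zero _ _ _
  have hv0 : v = fun _ => 0 := by
    refine Measure.eq_of_ae_eq (μ := volume) ?_ hv.continuous continuous_const
    filter_upwards [h2] with x hx
    simpa [hu0] using hx
  refine (Lp.eq_zero_iff_ae_eq_zero).mpr ?_
  filter_upwards [h3] with x hx
  simpa [hv0] using hx

/-- The maximal operator `A_p f = -(p f')'` on `L²(ℝ)`. -/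
noncomputable def sturmLiouville (p : ℝ → ℝ) : L2R →ₗ.[ℂ] L2R :=
  (sturmLiouvilleGraph p).toLinearPMap

theorem sturmLiouville_graph (p : ℝ → ℝ) :
    (sturmLiouville p).graph = sturmLiouvilleGraph p :=
  Submodule.toLinearPMap_graph_eq _ (fun w hw h0 => sturmLiouvilleGraph_single_valued p w hw h0)

/-! ### Spaces of continuous functions in `L²(ℝ)` and reproducing kernels -/

/-- The continuous functions on `ℝ` whose class in `L²(ℝ)` belongs to `V`. -/
def continuousElements (V : Submodule ℂ L2R) : Set (ℝ → ℂ) :=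
  {u | Continuous u ∧ ∃ f ∈ V, (f : ℝ → ℂ) =ᵐ[volume] u}

/-- Every element of `V` has a continuous representative, and with these representatives `V` is a
reproducing kernel Hilbert space with kernel `k`: `u x = ⟨u, k(x, ·)⟩`. -/
structure IsReproducingKernel (V : Submodule ℂ L2R) (k : ℝ → ℝ → ℂ) : Prop where
  exists_continuous : ∀ f ∈ V, ∃ u : ℝ → ℂ, Continuous u ∧ (f : ℝ → ℂ) =ᵐ[volume] u
  kernel_mem : ∀ x, k x ∈ continuousElements V
  reproducing : ∀ u ∈ continuousElements V, ∀ x, u x = ∫ y, u y * (starRingEnd ℂ) (k x y)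

/-! ### The two-valued parametrizing function -/

/-- `p = p₋` on `x ≤ 0` and `p = p₊` on `x > 0`. -/
noncomputable def toyP (pm pp : ℝ) (x : ℝ) : ℝ := if x ≤ 0 then pm else pp

open Real in
/-- The explicit kernel `k(x, y)`; here `Real.sinc t = sin t / t` and `Real.sinc 0 = 1`. -/
noncomputable def toyKernel (pm pp Ω : ℝ) (x y : ℝ) : ℂ :=
  ((if x ≤ 0 then
      if y ≤ 0 then
        √Ω / (π * √pm) * sinc (√Ω * ((x - y) / √pm))
          - (√pp - √pm) / (√pp + √pm) * (√Ω / (π * √pm)) * sinc (√Ω * ((x + y) / √pm))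
      else
        2 * √Ω / (π * (√pp + √pm)) * sinc (√Ω * (x / √pm - y / √pp))
    else
      if y ≤ 0 then
        2 * √Ω / (π * (√pp + √pm)) * sinc (√Ω * (x / √pp - y / √pm))
      else
        √Ω / (π * √pp) * sinc (√Ω * ((x - y) / √pp))
          + (√pp - √pm) / (√pp + √pm) * (√Ω / (π * √pp)) * sinc (√Ω * ((x + y) / √pp)) : ℝ) : ℂ)

/-- The sampling points `x_j = π j √p(j) / √Ω`. -/
noncomputable def toyPoint (pm pp Ω : ℝ) (j : ℤ) : ℝ :=
  Real.pi * j * √(toyP pm pp j) / √Ω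

/-- The weights `w_j`. -/
noncomputable def toyWeight (pm pp : ℝ) (j : ℤ) : ℝ :=
  if j < 0 then √pm else if 0 < j then √pp else (√pp + √pm) / 2

/-! Write `p₋ = α ^ 4` and `p₊ = β ^ 4`. The change of variables `t = x / √p(x)` straightens `A_p`
into `-d²/dt²` away from `0`. Composing it with a rotation in the plane spanned by `F` and its odd
reflection `sgn(t) F(-t)` gives a unitary operator of `L²(ℝ)`; the angle of the rotation is the one
which matches `u` and `p u'` across `0`, so that functions in the domain of `-d²/dt²` are carried to
the domain of `A_p`. After an inverse Fourier transform, `A_p` becomes multiplication by `(2πξ)²`: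
one inclusion of the graphs is a computation, and equality follows because `A_p + 1` is injective
while multiplication by `(2πξ)² + 1` is onto. A spectral measure of an operator is unique, so the
spectral projection on `[0, Ω]` is the cutoff to the frequency band `|2πξ| ≤ √Ω`. Hence an element
of the Paley–Wiener space is the image of a band-limited function, and integrating the product of
two generalized eigenfunctions over the band produces the kernel, a combination of two sinc
functions.

At `x_j` the variable `t` is `π j / √Ω`, where the sinc functions vanish except in the diagonal
case; so the kernel functions at these points are orthogonal. They are total: the values `u(x_j)`
and `u(x_{-j})` are obtained by the rotation from the values of `F` at `± π j / √Ω`, and these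
values of a band-limited function `F` are, up to scaling, the Fourier coefficients of its transform
on the band. Uniform convergence of the expansion follows from convergence in `L²`, since `k(x, x)`
is bounded. -/

/-! ### Uniqueness of the spectral measure -/

namespace ProjValuedMeasure

variable {H : Type*} [NormedAddCommGroup H] [InnerProductSpace ℂ H] [CompleteSpace H]
  (E : ProjValuedMeasure H)

theorem scalarMeasure_apply (f : H) {s : Set ℝ} (hs : MeasurableSet s) :
    E.scalarMeasure f s = ENNReal.ofReal (‖E.proj s f‖ ^ 2) :=
  Measure.ofMeasurable_apply s hs

theorem scalarMeasure_real_apply (f : H) {s : Set ℝ} (hs : MeasurableSet s) :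
    (E.scalarMeasure f).real s = ‖E.proj s f‖ ^ 2 := by
  rw [measureReal_def, E.scalarMeasure_apply f hs, ENNReal.toReal_ofReal (by positivity)]

instance isFiniteMeasure_scalarMeasure (f : H) : IsFiniteMeasure (E.scalarMeasure f) :=
  ⟨by rw [E.scalarMeasure_apply f MeasurableSet.univ]; exact ENNReal.ofReal_lt_top⟩

theorem scalarMeasure_real_univ (f : H) : (E.scalarMeasure f).real univ = ‖f‖ ^ 2 := by
  rw [E.scalarMeasure_real_apply f MeasurableSet.univ, E.proj_univ, one_apply_eq_self]

theorem inner_proj_left (s : Set ℝ) (x y : H) :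
    inner ℂ (E.proj s x) y = inner ℂ x (E.proj s y) :=
  (ContinuousLinearMap.isSelfAdjoint_iff_isSymmetric.1 (E.isStarProjection s).isSelfAdjoint) x y

theorem proj_proj {s t : Set ℝ} (hs : MeasurableSet s) (ht : MeasurableSet t) (x : H) :
    E.proj s (E.proj t x) = E.proj (s ∩ t) x :=
  congr($((E.proj_inter s t hs ht).symm) x)

theorem proj_comm {s t : Set ℝ} (hs : MeasurableSet s) (ht : MeasurableSet t) (x : H) :
    E.proj s (E.proj t x) = E.proj t (E.proj s x) := by
  rw [E.proj_proj hs ht, E.proj_proj ht hs, inter_comm]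

theorem proj_proj_self (s : Set ℝ) (x : H) : E.proj s (E.proj s x) = E.proj s x :=
  congr($((E.isStarProjection s).isIdempotentElem) x)

theorem norm_proj_le (s : Set ℝ) (x : H) : ‖E.proj s x‖ ≤ ‖x‖ := by
  simpa using (E.proj s).le_of_opNorm_le (E.isStarProjection s).norm_le x

theorem proj_empty : E.proj ∅ = 0 := by
  ext f
  have h := E.scalarMeasure_real_apply f MeasurableSet.empty
  simpa using h.symm

theorem proj_add_proj_compl {s : Set ℝ} (hs : MeasurableSet s) (x : H) :
    E.proj s x + E.proj sᶜ x = x := by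
  have h : ((E.proj s + E.proj sᶜ : H →L[ℂ] H) : H →ₗ[ℂ] H) = LinearMap.id := by
    refine (ext_inner_map _ _).1 fun y => ?_
    simp only [ContinuousLinearMap.coe_coe, add_apply, LinearMap.id_apply, inner_add_left,
      inner_proj_left, inner_proj, inner_self_eq_norm_sq_to_K]
    have := measureReal_add_measureReal_compl (μ := E.scalarMeasure y) hs
    rw [E.scalarMeasure_real_apply y hs, E.scalarMeasure_real_apply y hs.compl,
      E.scalarMeasure_real_univ] at this
    rw [← Complex.ofReal_add, this]
    exact Complex.ofReal_pow _ _
  exact congr($h x)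

theorem proj_proj_compl {s : Set ℝ} (hs : MeasurableSet s) (x : H) :
    E.proj s (E.proj sᶜ x) = 0 := by
  rw [E.proj_proj hs hs.compl, inter_compl_self, E.proj_empty, zero_apply]

theorem scalarMeasure_proj {s : Set ℝ} (hs : MeasurableSet s) (f : H) :
    E.scalarMeasure (E.proj s f) = (E.scalarMeasure f).restrict s := by
  ext t ht
  rw [Measure.restrict_apply ht, E.scalarMeasure_apply _ ht, E.scalarMeasure_apply _ (ht.inter hs),
    E.proj_proj ht hs]

theorem ae_mem_of_proj_eq_self {s : Set ℝ} (hs : MeasurableSet s) {x : H} (hx : E.proj s x = x) :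
    ∀ᵐ t ∂E.scalarMeasure x, t ∈ s := by
  rw [← hx, E.scalarMeasure_proj hs]
  exact ae_restrict_mem hs

theorem proj_eq_self_of_ae_mem {s : Set ℝ} (hs : MeasurableSet s) {x : H}
    (hx : ∀ᵐ t ∂E.scalarMeasure x, t ∈ s) : E.proj s x = x := by
  have h : ‖E.proj sᶜ x‖ ^ 2 = 0 := by
    have hnull : E.scalarMeasure x sᶜ = 0 := hx
    rw [← E.scalarMeasure_real_apply x hs.compl, measureReal_def, hnull, ENNReal.toReal_zero]
  simpa [norm_eq_zero.1 (pow_eq_zero_iff two_ne_zero |>.1 h)] using E.proj_add_proj_compl hs x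

theorem scalarMeasure_add {s : Set ℝ} (hs : MeasurableSet s) {x y : H} (hx : E.proj s x = x)
    (hy : E.proj sᶜ y = y) :
    E.scalarMeasure (x + y) = E.scalarMeasure x + E.scalarMeasure y := by
  ext t ht
  have orthogonal : inner ℂ (E.proj t x) (E.proj t y) = 0 := by
    rw [← hx, ← hy, E.proj_comm ht hs, E.proj_comm ht hs.compl, E.inner_proj_left,
      E.proj_proj_compl hs, inner_zero_right]
  rw [Measure.add_apply, E.scalarMeasure_apply _ ht, E.scalarMeasure_apply _ ht,
    E.scalarMeasure_apply _ ht, ← ENNReal.ofReal_add (by positivity) (by positivity), map_add,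
    sq, sq, sq, norm_add_sq_eq_norm_sq_add_norm_sq_of_inner_eq_zero _ _ orthogonal]

theorem tendsto_proj_of_monotone {s : ℕ → Set ℝ} (hs : ∀ n, MeasurableSet (s n))
    (hmono : Monotone s) (hU : ⋃ n, s n = univ) (x : H) :
    Tendsto (fun n => E.proj (s n) x) atTop (𝓝 x) := by
  have hmeasure : Tendsto (fun n => E.scalarMeasure x (s n)ᶜ) atTop (𝓝 0) := by
    have := tendsto_measure_iInter_atTop (μ := E.scalarMeasure x)
      (fun n => (hs n).compl.nullMeasurableSet)
      (fun m n hmn => compl_subset_compl.2 (hmono hmn)) ⟨0, measure_ne_top _ _⟩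
    rwa [← compl_iUnion, hU, compl_univ, measure_empty] at this
  have hnorm : ∀ n, √((E.scalarMeasure x).real (s n)ᶜ) = ‖E.proj (s n) x - x‖ := by
    intro n
    rw [E.scalarMeasure_real_apply x (hs n).compl, Real.sqrt_sq (norm_nonneg _), norm_sub_rev,
      ← eq_sub_of_add_eq' (E.proj_add_proj_compl (hs n) x)]
  rw [tendsto_iff_norm_sub_tendsto_zero]
  have := ((ENNReal.tendsto_toReal ENNReal.zero_ne_top).comp hmeasure).sqrt
  rw [ENNReal.toReal_zero, Real.sqrt_zero] at this
  exact this.congr hnorm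

theorem tendsto_proj_Icc (x : H) :
    Tendsto (fun n : ℕ => E.proj (Icc (-(n : ℝ)) n) x) atTop (𝓝 x) := by
  refine E.tendsto_proj_of_monotone (fun _ => measurableSet_Icc) (fun m n hmn => ?_)
    (eq_univ_of_forall fun t => ?_) x
  · have : (m : ℝ) ≤ n := by exact_mod_cast hmn
    exact Icc_subset_Icc (by linarith) this
  · obtain ⟨n, hn⟩ := exists_nat_ge |t|
    exact mem_iUnion.2 ⟨n, abs_le.1 hn⟩

theorem ext_scalarMeasure {E F : ProjValuedMeasure H}
    (h : ∀ f, E.scalarMeasure f = F.scalarMeasure f) : E = F := by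
  suffices E.proj = F.proj by
    cases E; cases F; congr
  funext s
  by_cases hs : MeasurableSet s
  · refine ContinuousLinearMap.coe_injective ((ext_inner_map _ _).1 fun f => ?_)
    have : ‖E.proj s f‖ ^ 2 = ‖F.proj s f‖ ^ 2 := by
      rw [← E.scalarMeasure_real_apply f hs, h f, F.scalarMeasure_real_apply f hs]
    simp only [ContinuousLinearMap.coe_coe, inner_proj_left, inner_proj, this]
  · rw [E.not_measurable s hs, F.not_measurable s hs]

end ProjValuedMeasure

theorem norm_apply_le_of_isSymmetric {𝕜 H : Type*} [RCLike 𝕜] [NormedAddCommGroup H]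
    [InnerProductSpace 𝕜 H] [CompleteSpace H] {T : H →ₗ[𝕜] H} (hT : T.IsSymmetric) {r : ℝ}
    (hr : 0 ≤ r) (h : ∀ x, |RCLike.re (inner 𝕜 (T x) x)| ≤ r * ‖x‖ ^ 2) (x : H) :
    ‖T x‖ ≤ r * ‖x‖ := by
  let T' : H →L[𝕜] H := ⟨T, hT.continuous⟩
  refine T'.le_of_opNorm_le ?_ x
  rw [T'.norm_eq_iSup_rayleighQuotient hT]
  refine ciSup_le fun y => ?_
  rw [ContinuousLinearMap.rayleighQuotient, T'.reApplyInnerSelf_apply, abs_div,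
    abs_of_nonneg (sq_nonneg ‖y‖)]
  exact div_le_of_le_mul₀ (by positivity) hr (h y)

namespace IsSpectralMeasure

variable {H : Type*} [NormedAddCommGroup H] [InnerProductSpace ℂ H] [CompleteSpace H]
  {A : H →ₗ.[ℂ] H} {E F : ProjValuedMeasure H}

theorem inner_of_mem_graph (hE : IsSpectralMeasure A E) {x x' : H} (h : (x, x') ∈ A.graph) :
    inner ℂ x x' = ((∫ t, t ∂E.scalarMeasure x : ℝ) : ℂ) := by
  obtain ⟨y, rfl, rfl⟩ := (LinearPMap.mem_graph_iff A).1 h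
  exact hE.inner_apply y

theorem memLp_id_of_mem_domain (hE : IsSpectralMeasure A E) {x : H} (h : x ∈ A.domain) :
    MemLp (fun t : ℝ => t) 2 (E.scalarMeasure x) := by
  refine (memLp_two_iff_integrable_sq (by fun_prop)).2 ⟨by fun_prop, ?_⟩
  rw [hasFiniteIntegral_iff_ofReal (Eventually.of_forall fun t => by positivity)]
  exact (hE.mem_domain_iff x).1 h

theorem integrable_id_of_mem_graph (hE : IsSpectralMeasure A E) {x x' : H}
    (h : (x, x') ∈ A.graph) : Integrable (fun t : ℝ => t) (E.scalarMeasure x) :=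
  (hE.memLp_id_of_mem_domain (LinearPMap.mem_domain_of_mem_graph h)).integrable (by norm_num)

theorem inner_sub_smul (hE : IsSpectralMeasure A E) {x x' : H} (hx : (x, x') ∈ A.graph) (c : ℝ) :
    inner ℂ x (x' - (c : ℂ) • x) = ((∫ t, (t - c) ∂E.scalarMeasure x : ℝ) : ℂ) := by
  rw [inner_sub_right, hE.inner_of_mem_graph hx, inner_smul_right, inner_self_eq_norm_sq_to_K,
    integral_sub (hE.integrable_id_of_mem_graph hx) (integrable_const _), integral_const,
    E.scalarMeasure_real_univ]
  push_cast
  simp [mul_comm]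

theorem proj_mem_domain (hE : IsSpectralMeasure A E) {s : Set ℝ} (hs : MeasurableSet s) {x : H}
    (h : x ∈ A.domain) : E.proj s x ∈ A.domain := by
  rw [hE.mem_domain_iff, E.scalarMeasure_proj hs]
  exact (lintegral_mono' Measure.restrict_le_self le_rfl).trans_lt ((hE.mem_domain_iff x).1 h)

theorem proj_mem_domain_of_isBounded (hE : IsSpectralMeasure A E) {s : Set ℝ}
    (hs : MeasurableSet s) (hb : Bornology.IsBounded s) (x : H) : E.proj s x ∈ A.domain := by
  obtain ⟨C, hC⟩ := isBounded_iff_forall_norm_le.1 hb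
  rw [hE.mem_domain_iff, E.scalarMeasure_proj hs]
  have hle : ∀ t ∈ s, ENNReal.ofReal (t ^ 2) ≤ ENNReal.ofReal (C ^ 2) := fun t ht =>
    ENNReal.ofReal_le_ofReal (sq_le_sq' (abs_le.1 (hC t ht)).1 (abs_le.1 (hC t ht)).2)
  refine (setLIntegral_mono measurable_const hle).trans_lt ?_
  rw [setLIntegral_const]
  exact ENNReal.mul_lt_top ENNReal.ofReal_lt_top (measure_lt_top _ _)

theorem exists_linearMap_graph_proj (hE : IsSpectralMeasure A E) {s : Set ℝ}
    (hs : MeasurableSet s) (hb : Bornology.IsBounded s) :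
    ∃ B : H →ₗ[ℂ] H, ∀ z, (E.proj s z, B z) ∈ A.graph :=
  ⟨A.toFun ∘ₗ (E.proj s : H →ₗ[ℂ] H).codRestrict A.domain
    (hE.proj_mem_domain_of_isBounded hs hb),
    fun z => A.mem_graph ⟨E.proj s z, _⟩⟩

theorem inner_eq_zero_of_proj_compl (hE : IsSpectralMeasure A E) {s : Set ℝ}
    (hs : MeasurableSet s) {x x' y y' : H} (hx : (x, x') ∈ A.graph) (hy : (y, y') ∈ A.graph)
    (hxs : E.proj s x = x) (hys : E.proj sᶜ y = y) : inner ℂ x y' = 0 := by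
  -- The quadratic form of `A` is additive on `x + y` and, by polarization, on `x + i y`.
  have cross : ∀ {z z' : H}, (z, z') ∈ A.graph → E.proj sᶜ z = z →
      inner ℂ x z' + inner ℂ z x' = 0 := by
    intro z z' hz hzs
    have h := hE.inner_of_mem_graph (A.graph.add_mem hx hz)
    simp only [inner_add_left, inner_add_right] at h
    rw [E.scalarMeasure_add hs hxs hzs, integral_add_measure (hE.integrable_id_of_mem_graph hx)
      (hE.integrable_id_of_mem_graph hz), Complex.ofReal_add, ← hE.inner_of_mem_graph hx,
      ← hE.inner_of_mem_graph hz] at h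
    linear_combination h
  have hy_cross := cross hy hys
  have hIy_cross := cross (A.graph.smul_mem Complex.I hy) (by rw [map_smul, hys])
  rw [inner_smul_right, inner_smul_left, Complex.conj_I] at hIy_cross
  have : Complex.I * (2 * inner ℂ x y') = 0 := by
    linear_combination hIy_cross + Complex.I * hy_cross
  simpa using this

theorem proj_apply_eq_self (hE : IsSpectralMeasure A E) {s : Set ℝ} (hs : MeasurableSet s)
    {y y' : H} (hy : (y, y') ∈ A.graph) (hys : E.proj s y = y) : E.proj s y' = y' := by
  suffices h : E.proj sᶜ y' = 0 by simpa [h] using E.proj_add_proj_compl hs y'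
  refine ext_inner_left ℂ fun z => ?_
  rw [inner_zero_right]
  have truncated : ∀ n : ℕ, inner ℂ (E.proj (Icc (-(n : ℝ)) n) z) (E.proj sᶜ y') = 0 := by
    intro n
    have hI : MeasurableSet (Icc (-(n : ℝ)) n) := measurableSet_Icc
    have hmem : E.proj sᶜ (E.proj (Icc (-(n : ℝ)) n) z) ∈ A.domain :=
      hE.proj_mem_domain hs.compl (hE.proj_mem_domain_of_isBounded hI (Metric.isBounded_Icc _ _) z)
    rw [← E.inner_proj_left]
    exact hE.inner_eq_zero_of_proj_compl hs.compl (A.mem_graph ⟨_, hmem⟩) hy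
      (E.proj_proj_self _ _) (by rwa [compl_compl])
  have := (E.tendsto_proj_Icc z).inner (𝕜 := ℂ) (tendsto_const_nhds (x := E.proj sᶜ y'))
  simp only [truncated] at this
  exact tendsto_nhds_unique this tendsto_const_nhds

theorem proj_mem_graph (hE : IsSpectralMeasure A E) {s : Set ℝ} (hs : MeasurableSet s)
    {x x' : H} (hx : (x, x') ∈ A.graph) : (E.proj s x, E.proj s x') ∈ A.graph := by
  have hdom := hE.proj_mem_domain hs (LinearPMap.mem_domain_of_mem_graph hx)
  set y := A ⟨E.proj s x, hdom⟩
  have hy : (E.proj s x, y) ∈ A.graph := A.mem_graph ⟨E.proj s x, hdom⟩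
  have hcompl : (E.proj sᶜ x, x' - y) ∈ A.graph := by
    have := A.graph.sub_mem hx hy
    rwa [Prod.mk_sub_mk, ← eq_sub_of_add_eq' (E.proj_add_proj_compl hs x)] at this
  have hsub : E.proj s (x' - y) = 0 := by
    rw [← hE.proj_apply_eq_self hs.compl hcompl (E.proj_proj_self _ x), E.proj_proj_compl hs]
  rw [map_sub, hE.proj_apply_eq_self hs hy (E.proj_proj_self s x), sub_eq_zero] at hsub
  rwa [hsub]

theorem norm_sub_smul_le (hE : IsSpectralMeasure A E) {c r : ℝ} (hr : 0 ≤ r) {x x' : H}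
    (hx : (x, x') ∈ A.graph) (hxs : E.proj (Icc (c - r) (c + r)) x = x) :
    ‖x' - (c : ℂ) • x‖ ≤ r * ‖x‖ := by
  set I := Icc (c - r) (c + r)
  have hI : MeasurableSet I := measurableSet_Icc
  obtain ⟨B, hB⟩ := hE.exists_linearMap_graph_proj hI (Metric.isBounded_Icc _ _)
  let T : H →ₗ[ℂ] H := B - (c : ℂ) • (E.proj I : H →ₗ[ℂ] H)
  have hTx : T x = x' - (c : ℂ) • x := by
    have hBx := hB x
    rw [hxs] at hBx
    simp only [T, LinearMap.sub_apply, LinearMap.smul_apply, ContinuousLinearMap.coe_coe, hxs,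
      A.mem_graph_snd_inj hBx hx rfl]
  have hTform : ∀ z, inner ℂ z (T z) =
      ((∫ t, (t - c) ∂E.scalarMeasure (E.proj I z) : ℝ) : ℂ) := by
    intro z
    rw [← hE.inner_sub_smul (hB z) c, E.inner_proj_left, map_sub, map_smul, E.proj_proj_self,
      hE.proj_apply_eq_self hI (hB z) (E.proj_proj_self I z)]
    rfl
  have hTsymm : T.IsSymmetric := by
    refine (LinearMap.isSymmetric_iff_inner_map_self_real T).2 fun z => ?_
    rw [← inner_conj_symm, hTform, Complex.conj_ofReal, Complex.conj_ofReal]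
  rw [← hTx]
  refine norm_apply_le_of_isSymmetric hTsymm hr (fun z => ?_) x
  have hbound : ∀ᵐ t ∂E.scalarMeasure (E.proj I z), ‖t - c‖ ≤ r := by
    filter_upwards [E.ae_mem_of_proj_eq_self hI (E.proj_proj_self I z)] with t ht
    exact abs_le.2 ⟨by linarith [ht.1], by linarith [ht.2]⟩
  rw [← inner_conj_symm, hTform, Complex.conj_ofReal, RCLike.re_eq_complex_re, Complex.ofReal_re]
  calc |∫ t, (t - c) ∂E.scalarMeasure (E.proj I z)|
      ≤ r * ‖E.proj I z‖ ^ 2 := by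
        simpa [E.scalarMeasure_real_univ] using norm_integral_le_of_norm_le_const hbound
    _ ≤ r * ‖z‖ ^ 2 := by gcongr; exact E.norm_proj_le I z

theorem le_norm_sub_smul (hF : IsSpectralMeasure A F) {c δ : ℝ} {s : Set ℝ} (hs : MeasurableSet s)
    (hsub : s ⊆ Iic (c - δ) ∨ s ⊆ Ici (c + δ)) {x x' : H} (hx : (x, x') ∈ A.graph)
    (hxs : F.proj s x = x) : δ * ‖x‖ ≤ ‖x' - (c : ℂ) • x‖ := by
  have hint : Integrable (fun t : ℝ => t - c) (F.scalarMeasure x) :=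
    (hF.integrable_id_of_mem_graph hx).sub (integrable_const c)
  have hconst : ∫ _, δ ∂F.scalarMeasure x = δ * ‖x‖ ^ 2 := by
    rw [integral_const, F.scalarMeasure_real_univ, smul_eq_mul, mul_comm]
  have hmem := F.ae_mem_of_proj_eq_self hs hxs
  have hform : δ * ‖x‖ ^ 2 ≤ |∫ t, (t - c) ∂F.scalarMeasure x| := by
    rw [← hconst]
    rcases hsub with h | h
    · refine le_trans ?_ (neg_le_abs _)
      rw [← integral_neg]
      refine integral_mono_ae (integrable_const _) hint.neg ?_
      filter_upwards [hmem] with t ht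
      linarith [mem_Iic.1 (h ht)]
    · refine le_trans ?_ (le_abs_self _)
      refine integral_mono_ae (integrable_const _) hint ?_
      filter_upwards [hmem] with t ht
      linarith [mem_Ici.1 (h ht)]
  have hcs := norm_inner_le_norm (𝕜 := ℂ) x (x' - (c : ℂ) • x)
  rw [hF.inner_sub_smul hx, Complex.norm_real, Real.norm_eq_abs] at hcs
  rcases (norm_nonneg x).eq_or_lt with h0 | hpos
  · rw [← h0, mul_zero]; positivity
  · exact le_of_mul_le_mul_left (by linarith) hpos

theorem proj_proj_eq_zero (hE : IsSpectralMeasure A E) (hF : IsSpectralMeasure A F)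
    {c r δ : ℝ} (hr : 0 ≤ r) (hδ : r < δ) {s : Set ℝ} (hs : MeasurableSet s)
    (hsub : s ⊆ Iic (c - δ) ∨ s ⊆ Ici (c + δ)) (x : H) :
    F.proj s (E.proj (Icc (c - r) (c + r)) x) = 0 := by
  set I := Icc (c - r) (c + r)
  have hI : MeasurableSet I := measurableSet_Icc
  obtain ⟨B, hB⟩ := hE.exists_linearMap_graph_proj hI (Metric.isBounded_Icc _ _)
  have hδ0 : 0 < δ := hr.trans_lt hδ
  -- `A - c` is bounded by `r` on the range of `E I` and below by `δ` on that of `F s`, and it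
  -- commutes with both; so `δ ‖X z‖ ≤ ‖X‖ r ‖z‖` for the product `X` of the two projections.
  set X : H →L[ℂ] H := F.proj s * E.proj I
  have hX : ∀ z, ‖X z‖ ≤ ‖X‖ * r / δ * ‖z‖ := by
    intro z
    have hcomm : F.proj s (B z) - (c : ℂ) • F.proj s (E.proj I z) =
        X (B z - (c : ℂ) • E.proj I z) := by
      change _ = F.proj s (E.proj I (B z - (c : ℂ) • E.proj I z))
      simp only [map_sub, map_smul, E.proj_proj_self,
        hE.proj_apply_eq_self hI (hB z) (E.proj_proj_self I z)]
    rw [div_mul_eq_mul_div, le_div_iff₀ hδ0, mul_comm, mul_assoc]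
    calc δ * ‖F.proj s (E.proj I z)‖
        ≤ ‖F.proj s (B z) - (c : ℂ) • F.proj s (E.proj I z)‖ :=
          hF.le_norm_sub_smul hs hsub (hF.proj_mem_graph hs (hB z)) (F.proj_proj_self s _)
      _ ≤ ‖X‖ * ‖B z - (c : ℂ) • E.proj I z‖ := hcomm ▸ X.le_opNorm _
      _ ≤ ‖X‖ * (r * ‖E.proj I z‖) := by
          gcongr; exact hE.norm_sub_smul_le hr (hB z) (E.proj_proj_self I z)
      _ ≤ ‖X‖ * (r * ‖z‖) := by gcongr; exact E.norm_proj_le I z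
  have hXnorm : ‖X‖ * δ ≤ ‖X‖ * r := by
    rw [← le_div_iff₀ hδ0]
    exact X.opNorm_le_bound (by positivity) hX
  have hX0 : X = 0 := by
    by_contra hne
    exact hδ.not_ge (le_of_mul_le_mul_left hXnorm (norm_pos_iff.2 hne))
  exact congr($hX0 x)

theorem proj_Icc_proj_Icc (hE : IsSpectralMeasure A E) (hF : IsSpectralMeasure A F) {a b : ℝ}
    (hab : a ≤ b) (x : H) : F.proj (Icc a b) (E.proj (Icc a b) x) = E.proj (Icc a b) x := by
  obtain ⟨c, r, rfl, rfl⟩ : ∃ c r, a = c - r ∧ b = c + r :=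
    ⟨(a + b) / 2, (b - a) / 2, by ring, by ring⟩
  have hr : 0 ≤ r := by linarith
  set y := E.proj (Icc (c - r) (c + r)) x
  have hδ : ∀ n : ℕ, r < r + 1 / (n + 1) := fun n => lt_add_of_pos_right r Nat.one_div_pos_of_nat
  have hlim : Tendsto (fun n : ℕ => r + 1 / ((n : ℝ) + 1)) atTop (𝓝 r) := by
    simpa using tendsto_one_div_add_atTop_nhds_zero_nat.const_add r
  have hnull : ∀ s, MeasurableSet s → ∀ n : ℕ, s ⊆ Iic (c - (r + 1 / (n + 1))) ∨
      s ⊆ Ici (c + (r + 1 / (n + 1))) → F.scalarMeasure y s = 0 := fun s hs n h => by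
    rw [F.scalarMeasure_apply y hs, hE.proj_proj_eq_zero hF hr (hδ n) hs h]
    simp
  have hIio : F.scalarMeasure y (Iio (c - r)) = 0 := by
    rw [← iUnion_Iic_eq_Iio_of_lt_of_tendsto (fun n => sub_lt_sub_left (hδ n) c)
      (hlim.const_sub c)]
    exact measure_iUnion_null fun n => hnull _ measurableSet_Iic n (Or.inl Subset.rfl)
  have hIoi : F.scalarMeasure y (Ioi (c + r)) = 0 := by
    rw [← iUnion_Ici_eq_Ioi_of_lt_of_tendsto (fun n => add_lt_add_right (hδ n) c)
      (hlim.const_add c)]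
    exact measure_iUnion_null fun n => hnull _ measurableSet_Ici n (Or.inr Subset.rfl)
  refine F.proj_eq_self_of_ae_mem measurableSet_Icc ?_
  filter_upwards [measure_eq_zero_iff_ae_notMem.1 hIio, measure_eq_zero_iff_ae_notMem.1 hIoi]
    with t hl hu
  exact ⟨not_lt.1 hl, not_lt.1 hu⟩

theorem unique (hE : IsSpectralMeasure A E) (hF : IsSpectralMeasure A F) : E = F := by
  have hproj : ∀ {a b : ℝ}, a ≤ b → E.proj (Icc a b) = F.proj (Icc a b) := by
    intro a b hab
    ext x
    rw [← hE.proj_Icc_proj_Icc hF hab x]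
    refine ext_inner_left ℂ fun z => ?_
    rw [← F.inner_proj_left, ← E.inner_proj_left, hF.proj_Icc_proj_Icc hE hab, F.inner_proj_left]
  refine ProjValuedMeasure.ext_scalarMeasure fun f => Measure.ext_of_Icc _ _ fun a b hab => ?_
  rw [E.scalarMeasure_apply f measurableSet_Icc, F.scalarMeasure_apply f measurableSet_Icc,
    hproj hab]

theorem spectralProjection_eq (hE : IsSpectralMeasure A E) (s : Set ℝ) :
    spectralProjection A s = E.proj s := by
  have h : ∃ E : ProjValuedMeasure H, IsSpectralMeasure A E := ⟨E, hE⟩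
  rw [spectralProjection, dif_pos h, h.choose_spec.unique hE]

end IsSpectralMeasure

theorem isClosed_paleyWiener {H : Type*} [NormedAddCommGroup H] [InnerProductSpace ℂ H]
    [CompleteSpace H] (A : H →ₗ.[ℂ] H) (s : Set ℝ) : IsClosed (paleyWiener A s : Set H) := by
  have hidem : IsIdempotentElem (spectralProjection A s) := by
    unfold spectralProjection
    split_ifs with h
    · exact (h.choose.isStarProjection s).isIdempotentElem
    · exact IsIdempotentElem.zero
  exact ContinuousLinearMap.IsIdempotentElem.isClosed_range hidem

/-! ### Spectral measures of multiplication operators -/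

section IndicatorCLM

variable {X 𝕜 E : Type*} [MeasurableSpace X] {μ : Measure X} [RCLike 𝕜]

section NormedSpace

variable [NormedAddCommGroup E] [NormedSpace 𝕜 E] {p : ℝ≥0∞} [Fact (1 ≤ p)]

/-- Multiplication by the indicator function of a measurable set on `Lᵖ(μ)`. -/
noncomputable def indicatorCLM (𝕜 : Type*) [RCLike 𝕜] [NormedSpace 𝕜 E] {S : Set X}
    (hS : MeasurableSet S) : Lp E p μ →L[𝕜] Lp E p μ :=
  (ContinuousLinearMap.lsmul 𝕜 𝕜).holderL μ ∞ p p
    (((memLp_top_const (1 : 𝕜)).indicator hS).toLp (S.indicator fun _ => 1))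

theorem coeFn_indicatorCLM {S : Set X} (hS : MeasurableSet S) (f : Lp E p μ) :
    indicatorCLM 𝕜 hS f =ᵐ[μ] S.indicator f := by
  have hone := ((memLp_top_const (μ := μ) (1 : 𝕜)).indicator hS).coeFn_toLp
  filter_upwards [(ContinuousLinearMap.lsmul 𝕜 𝕜).coeFn_holder (r := p)
    (((memLp_top_const (1 : 𝕜)).indicator hS).toLp (S.indicator fun _ => 1)) f, hone] with x h1 h2
  refine h1.trans ?_
  rw [h2]
  by_cases hx : x ∈ S <;> simp [hx]

theorem indicatorCLM_univ (f : Lp E p μ) : indicatorCLM 𝕜 MeasurableSet.univ f = f := by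
  refine Lp.ext ((coeFn_indicatorCLM _ f).trans ?_)
  rw [indicator_univ]

theorem indicatorCLM_indicatorCLM {S T : Set X} (hS : MeasurableSet S) (hT : MeasurableSet T)
    (f : Lp E p μ) :
    indicatorCLM 𝕜 hS (indicatorCLM 𝕜 hT f) = indicatorCLM 𝕜 (hS.inter hT) f := by
  refine Lp.ext ?_
  filter_upwards [coeFn_indicatorCLM (𝕜 := 𝕜) hS (indicatorCLM 𝕜 hT f),
    coeFn_indicatorCLM (𝕜 := 𝕜) hT f, coeFn_indicatorCLM (𝕜 := 𝕜) (hS.inter hT) f] with x h1 h2 h3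
  rw [h1, h3, ← indicator_indicator]
  by_cases hx : x ∈ S <;> simp [hx, h2]

theorem indicatorCLM_sub_indicatorCLM {S T : Set X} (hS : MeasurableSet S) (hT : MeasurableSet T)
    (hTS : T ⊆ S) (f : Lp E p μ) :
    indicatorCLM 𝕜 hS f - indicatorCLM 𝕜 hT f = indicatorCLM 𝕜 (hS.diff hT) f := by
  refine Lp.ext ?_
  filter_upwards [coeFn_indicatorCLM (𝕜 := 𝕜) hS f, coeFn_indicatorCLM (𝕜 := 𝕜) hT f,
    coeFn_indicatorCLM (𝕜 := 𝕜) (hS.diff hT) f,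
    Lp.coeFn_sub (indicatorCLM 𝕜 hS f) (indicatorCLM 𝕜 hT f)] with x h1 h2 h3 h4
  rw [h4, h3, Pi.sub_apply, h1, h2, indicator_sdiff hTS, Pi.sub_apply]

theorem sum_indicatorCLM {ι : Type*} [Countable ι] {S : ι → Set X} (hS : ∀ i, MeasurableSet (S i))
    (hd : Pairwise (Function.onFun Disjoint S)) (t : Finset ι) (f : Lp E p μ) :
    ∑ i ∈ t, indicatorCLM 𝕜 (hS i) f =
      indicatorCLM 𝕜 (t.measurableSet_biUnion fun i _ => hS i) f := by
  refine Lp.ext ?_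
  have hterm : ∀ᵐ x ∂μ, ∀ i, indicatorCLM 𝕜 (hS i) f x = (S i).indicator f x :=
    ae_all_iff.2 fun i => coeFn_indicatorCLM (hS i) f
  filter_upwards [hterm, Lp.coeFn_finsetSum t (fun i => indicatorCLM 𝕜 (hS i) f),
    coeFn_indicatorCLM (𝕜 := 𝕜) (t.measurableSet_biUnion fun i _ => hS i) f] with x h1 h2 h3
  rw [h2, h3, Finset.sum_apply, Finset.indicator_biUnion_apply]
  · exact Finset.sum_congr rfl fun i _ => h1 i
  · exact fun i _ j _ hij => hd hij

end NormedSpace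

section InnerProductSpace

variable [NormedAddCommGroup E] [InnerProductSpace 𝕜 E]

theorem inner_indicatorCLM {S : Set X} (hS : MeasurableSet S) (f g : Lp E 2 μ) :
    inner 𝕜 (indicatorCLM 𝕜 hS f) g = inner 𝕜 f (indicatorCLM 𝕜 hS g) := by
  rw [L2.inner_def, L2.inner_def]
  refine integral_congr_ae ?_
  filter_upwards [coeFn_indicatorCLM (𝕜 := 𝕜) hS f, coeFn_indicatorCLM (𝕜 := 𝕜) hS g] with x h1 h2
  rw [h1, h2]
  by_cases hx : x ∈ S <;> simp [hx]

theorem isStarProjection_indicatorCLM [CompleteSpace E] {S : Set X} (hS : MeasurableSet S) :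
    IsStarProjection (indicatorCLM 𝕜 hS : Lp E 2 μ →L[𝕜] Lp E 2 μ) where
  isIdempotentElem := by
    ext1 f
    refine (indicatorCLM_indicatorCLM hS hS f).trans ?_
    simp only [inter_self]
  isSelfAdjoint :=
    ContinuousLinearMap.isSelfAdjoint_iff_isSymmetric.2 fun f g => inner_indicatorCLM hS f g

end InnerProductSpace

variable [NormedAddCommGroup E]

theorem norm_sq_Lp_two (f : Lp E 2 μ) : ‖f‖ ^ 2 = ∫ x, ‖f x‖ ^ 2 ∂μ := by
  have hnonneg : 0 ≤ ∫ x, ‖f x‖ ^ 2 ∂μ := integral_nonneg fun x => sq_nonneg _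
  rw [Lp.norm_def, (Lp.memLp f).eLpNorm_eq_integral_rpow_norm two_ne_zero ENNReal.ofNat_ne_top,
    ENNReal.toReal_ofReal (by positivity), ENNReal.toReal_ofNat, ← Real.rpow_mul_natCast]
  · simp
  · simpa using hnonneg

theorem integrable_norm_sq_Lp_two (f : Lp E 2 μ) : Integrable (fun x => ‖f x‖ ^ 2) μ :=
  (Lp.memLp f).integrable_norm_pow two_ne_zero

variable [NormedSpace 𝕜 E]

theorem norm_sq_indicatorCLM {S : Set X} (hS : MeasurableSet S) (f : Lp E 2 μ) :
    ‖indicatorCLM 𝕜 hS f‖ ^ 2 = ∫ x in S, ‖f x‖ ^ 2 ∂μ := by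
  rw [norm_sq_Lp_two, ← integral_indicator hS]
  refine integral_congr_ae ?_
  filter_upwards [coeFn_indicatorCLM (𝕜 := 𝕜) hS f] with x h1
  rw [h1]
  by_cases hx : x ∈ S <;> simp [hx]

theorem hasSum_indicatorCLM {ι : Type*} [Countable ι] {S : ι → Set X}
    (hS : ∀ i, MeasurableSet (S i)) (hd : Pairwise (Function.onFun Disjoint S)) (f : Lp E 2 μ) :
    HasSum (fun i => indicatorCLM 𝕜 (hS i) f) (indicatorCLM 𝕜 (MeasurableSet.iUnion hS) f) := by
  have hpartial : ∀ t : Finset ι, MeasurableSet (⋃ i ∈ t, S i) :=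
    fun t => t.measurableSet_biUnion fun i _ => hS i
  have hnorm : ∀ t : Finset ι, √(∫ x in (⋃ i, S i) \ ⋃ i ∈ t, S i, ‖f x‖ ^ 2 ∂μ) =
      ‖∑ i ∈ t, indicatorCLM 𝕜 (hS i) f - indicatorCLM 𝕜 (MeasurableSet.iUnion hS) f‖ := by
    intro t
    rw [sum_indicatorCLM hS hd, norm_sub_rev, indicatorCLM_sub_indicatorCLM _ (hpartial t)
      (iUnion₂_subset fun i _ => subset_iUnion S i),
      ← norm_sq_indicatorCLM (𝕜 := 𝕜) ((MeasurableSet.iUnion hS).diff (hpartial t)),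
      Real.sqrt_sq (norm_nonneg _)]
  have htail : Tendsto (fun t : Finset ι => ∫ x in (⋃ i, S i) \ ⋃ i ∈ t, S i, ‖f x‖ ^ 2 ∂μ) atTop
      (𝓝 0) := by
    have hempty : ⋂ t : Finset ι, (⋃ i, S i) \ ⋃ i ∈ t, S i = ∅ := by
      refine eq_empty_of_forall_notMem fun x hx => ?_
      obtain ⟨i, hi⟩ := mem_iUnion.1 (mem_iInter.1 hx ∅).1
      exact (mem_iInter.1 hx {i}).2 (by simpa using hi)
    have := tendsto_setIntegral_of_antitone
      (fun t : Finset ι => (MeasurableSet.iUnion hS).diff (hpartial t))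
      (fun s t hst => sdiff_subset_sdiff_right (biUnion_subset_biUnion_left hst))
      ⟨∅, (integrable_norm_sq_Lp_two f).integrableOn⟩
    rwa [hempty, setIntegral_empty] at this
  rw [HasSum, tendsto_iff_norm_sub_tendsto_zero]
  simpa using htail.sqrt.congr hnorm

end IndicatorCLM

section MultiplicationPVM

variable {X H : Type*} [MeasurableSpace X] {μ : Measure X} [NormedAddCommGroup H]
  [InnerProductSpace ℂ H] [CompleteSpace H] {m : X → ℝ}

open Classical in
/-- The spectral measure of the operator that the unitary `W` turns into multiplication by `m` on
`L²(μ)`: its projections are multiplications by the indicator functions of `m ⁻¹' s`. -/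
noncomputable def multiplicationPVM (W : Lp ℂ 2 μ ≃ₗᵢ[ℂ] H) (hm : Measurable m) :
    ProjValuedMeasure H where
  proj s := if hs : MeasurableSet s then W.conjStarAlgEquiv (indicatorCLM ℂ (hm hs)) else 0
  isStarProjection s := by
    split_ifs with hs
    · exact (isStarProjection_indicatorCLM (hm hs)).map W.conjStarAlgEquiv
    · exact IsStarProjection.zero _
  not_measurable s hs := dif_neg hs
  proj_univ := by
    rw [dif_pos MeasurableSet.univ, ← map_one W.conjStarAlgEquiv]
    congr 1
    ext1 φ
    exact indicatorCLM_univ φ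
  proj_inter s t hs ht := by
    rw [dif_pos hs, dif_pos ht, dif_pos (hs.inter ht), ← map_mul]
    congr 1
    ext1 φ
    exact (indicatorCLM_indicatorCLM (hm hs) (hm ht) φ).symm
  hasSum_iUnion s hs hd f := by
    simp only [hs, dif_pos, MeasurableSet.iUnion hs, preimage_iUnion,
      LinearIsometryEquiv.conjStarAlgEquiv_apply_apply]
    exact (W.toContinuousLinearEquiv : Lp ℂ 2 μ →L[ℂ] H).hasSum
      (hasSum_indicatorCLM (fun n => hm (hs n)) (fun i j hij => (hd hij).preimage m) (W.symm f))

theorem multiplicationPVM_proj (W : Lp ℂ 2 μ ≃ₗᵢ[ℂ] H) (hm : Measurable m) {s : Set ℝ}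
    (hs : MeasurableSet s) (φ : Lp ℂ 2 μ) :
    (multiplicationPVM W hm).proj s (W φ) = W (indicatorCLM ℂ (hm hs) φ) := by
  simp only [multiplicationPVM, dif_pos hs, LinearIsometryEquiv.conjStarAlgEquiv_apply_apply,
    LinearIsometryEquiv.symm_apply_apply]

theorem scalarMeasure_multiplicationPVM (W : Lp ℂ 2 μ ≃ₗᵢ[ℂ] H) (hm : Measurable m)
    (φ : Lp ℂ 2 μ) : (multiplicationPVM W hm).scalarMeasure (W φ) =
      (μ.withDensity fun x => ENNReal.ofReal (‖φ x‖ ^ 2)).map m := by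
  ext s hs
  rw [ProjValuedMeasure.scalarMeasure_apply _ _ hs, multiplicationPVM_proj W hm hs,
    Measure.map_apply hm hs, withDensity_apply _ (hm hs), W.norm_map, norm_sq_indicatorCLM,
    ofReal_integral_eq_lintegral_ofReal (integrable_norm_sq_Lp_two φ).integrableOn
      (Eventually.of_forall fun x => by positivity)]

theorem lintegral_sq_scalarMeasure_multiplicationPVM (W : Lp ℂ 2 μ ≃ₗᵢ[ℂ] H) (hm : Measurable m)
    (φ : Lp ℂ 2 μ) :
    ∫⁻ t, ENNReal.ofReal (t ^ 2) ∂(multiplicationPVM W hm).scalarMeasure (W φ) =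
      ∫⁻ x, ENNReal.ofReal (‖(m x : ℂ) * φ x‖ ^ 2) ∂μ := by
  have hdensity : AEMeasurable (fun x => ENNReal.ofReal (‖φ x‖ ^ 2)) μ :=
    (integrable_norm_sq_Lp_two φ).aestronglyMeasurable.aemeasurable.ennreal_ofReal
  rw [scalarMeasure_multiplicationPVM, lintegral_map (by fun_prop) hm,
    lintegral_withDensity_eq_lintegral_mul₀ hdensity (by fun_prop)]
  refine lintegral_congr fun x => ?_
  rw [Pi.mul_apply, ← ENNReal.ofReal_mul (by positivity), norm_mul, mul_pow, Complex.norm_real,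
    Real.norm_eq_abs, sq_abs, mul_comm]

theorem integral_scalarMeasure_multiplicationPVM (W : Lp ℂ 2 μ ≃ₗᵢ[ℂ] H) (hm : Measurable m)
    (φ : Lp ℂ 2 μ) :
    ∫ t, t ∂(multiplicationPVM W hm).scalarMeasure (W φ) = ∫ x, ‖φ x‖ ^ 2 * m x ∂μ := by
  rw [scalarMeasure_multiplicationPVM, integral_map hm.aemeasurable (by fun_prop),
    integral_withDensity_eq_integral_toReal_smul₀
      (integrable_norm_sq_Lp_two φ).aestronglyMeasurable.aemeasurable.ennreal_ofReal
      (Eventually.of_forall fun x => ENNReal.ofReal_lt_top)]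
  simp only [ENNReal.toReal_ofReal (sq_nonneg _), smul_eq_mul]

theorem isSpectralMeasure_multiplicationPVM (W : Lp ℂ 2 μ ≃ₗᵢ[ℂ] H) (hm : Measurable m)
    {A : H →ₗ.[ℂ] H}
    (hA : ∀ φ ψ : Lp ℂ 2 μ, (W φ, W ψ) ∈ A.graph ↔ ψ =ᵐ[μ] fun x => (m x : ℂ) * φ x) :
    IsSpectralMeasure A (multiplicationPVM W hm) where
  mem_domain_iff f := by
    obtain ⟨φ, rfl⟩ := W.surjective f
    have hmeas : AEStronglyMeasurable (fun x => (m x : ℂ) * φ x) μ :=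
      (Complex.measurable_ofReal.comp hm).aestronglyMeasurable.mul (Lp.aestronglyMeasurable φ)
    have hdomain : W φ ∈ A.domain ↔ MemLp (fun x => (m x : ℂ) * φ x) 2 μ := by
      rw [LinearPMap.mem_domain_iff]
      constructor
      · rintro ⟨y, hy⟩
        obtain ⟨ψ, rfl⟩ := W.surjective y
        exact (memLp_congr_ae ((hA φ ψ).1 hy)).1 (Lp.memLp ψ)
      · intro h
        exact ⟨W (h.toLp _), (hA _ _).2 h.coeFn_toLp⟩
    rw [hdomain, memLp_two_iff_integrable_sq_norm hmeas,
      lintegral_sq_scalarMeasure_multiplicationPVM,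
      ← hasFiniteIntegral_iff_ofReal (Eventually.of_forall fun x => by positivity)]
    exact ⟨fun h => h.2, fun h => ⟨hmeas.norm.pow 2, h⟩⟩
  inner_apply := by
    rintro ⟨f, hf⟩
    obtain ⟨φ, rfl⟩ := W.surjective f
    obtain ⟨ψ, hψ⟩ := W.surjective (A ⟨W φ, hf⟩)
    have hae := (hA φ ψ).1 (by rw [hψ]; exact A.mem_graph ⟨W φ, hf⟩)
    rw [← hψ, W.inner_map_map, L2.inner_def, integral_scalarMeasure_multiplicationPVM,
      ← integral_complex_ofReal]
    refine integral_congr_ae ?_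
    filter_upwards [hae] with x hx
    rw [hx, RCLike.inner_apply, mul_assoc, Complex.mul_conj']
    push_cast
    ring

theorem mem_paleyWiener_iff_of_mem_graph_iff (W : Lp ℂ 2 μ ≃ₗᵢ[ℂ] H) (hm : Measurable m)
    {A : H →ₗ.[ℂ] H}
    (hA : ∀ φ ψ : Lp ℂ 2 μ, (W φ, W ψ) ∈ A.graph ↔ ψ =ᵐ[μ] fun x => (m x : ℂ) * φ x)
    {s : Set ℝ} (hs : MeasurableSet s) (φ : Lp ℂ 2 μ) :
    W φ ∈ paleyWiener A s ↔ ∀ᵐ x ∂μ, m x ∉ s → φ x = 0 := by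
  have hproj : ∀ χ, spectralProjection A s (W χ) = W (indicatorCLM ℂ (hm hs) χ) := fun χ => by
    rw [(isSpectralMeasure_multiplicationPVM W hm hA).spectralProjection_eq,
      multiplicationPVM_proj W hm hs]
  constructor
  · rintro ⟨g, hg⟩
    obtain ⟨χ, rfl⟩ := W.surjective g
    rw [← W.injective ((hproj χ).symm.trans hg)]
    filter_upwards [coeFn_indicatorCLM (𝕜 := ℂ) (hm hs) χ] with x hx hxs
    rw [hx, indicator_of_notMem (s := m ⁻¹' s) hxs]
  · intro h
    refine ⟨W φ, (hproj φ).trans (congrArg W (Lp.ext ?_))⟩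
    filter_upwards [coeFn_indicatorCLM (𝕜 := ℂ) (hm hs) φ, h] with x hx hφx
    rw [hx, indicator_apply_eq_self]
    exact hφx

end MultiplicationPVM

/-! ### Fourier integrals and primitives -/

section FourierLp

open scoped FourierTransform SchwartzMap ContDiff

variable {V F : Type*} [NormedAddCommGroup V] [InnerProductSpace ℝ V] [FiniteDimensional ℝ V]
  [MeasurableSpace V] [BorelSpace V] [NormedAddCommGroup F]

theorem continuous_fourier [NormedSpace ℂ F] {f : V → F} (hf : Integrable f) :
    Continuous (𝓕 f) :=
  VectorFourier.fourierIntegral_continuous Real.continuous_fourierChar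
    (by exact continuous_inner) hf

theorem continuous_fourierInv [NormedSpace ℂ F] {f : V → F} (hf : Integrable f) :
    Continuous (𝓕⁻ f) := by
  rw [funext (Real.fourierInv_eq_fourier_neg f)]
  exact (continuous_fourier hf).comp continuous_neg

theorem ae_eq_of_integral_schwartzMap_smul_eq [NormedSpace ℂ F] [CompleteSpace F] {f g : V → F}
    (hf : LocallyIntegrable f) (hg : LocallyIntegrable g)
    (h : ∀ G : 𝓢(V, ℂ), ∫ x, G x • f x = ∫ x, G x • g x) : f =ᵐ[volume] g := by
  refine ae_eq_of_integral_contDiff_smul_eq hf hg fun G hG hGc => ?_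
  have hc : HasCompactSupport (Complex.ofRealCLM ∘ G) := hGc.comp_left rfl
  have hs : ContDiff ℝ ∞ (Complex.ofRealCLM ∘ G) := by fun_prop
  have hint := h (hc.toSchwartzMap hs)
  simp only [HasCompactSupport.toSchwartzMap_toFun, Function.comp_apply,
    Complex.ofRealCLM_apply, Complex.coe_smul] at hint
  exact hint

variable [InnerProductSpace ℂ F] [CompleteSpace F]

theorem coeFn_fourier_Lp_two (f : Lp F 2 (volume : Measure V)) (hf : Integrable f) :
    (𝓕 f : Lp F 2 (volume : Measure V)) =ᵐ[volume] 𝓕 (f : V → F) := by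
  refine ae_eq_of_integral_schwartzMap_smul_eq ((Lp.memLp _).locallyIntegrable (by norm_num))
    (continuous_fourier hf).locallyIntegrable fun G => ?_
  have hdual := congrArg (fun T => T G) (Lp.fourier_toTemperedDistribution_eq f)
  simp only [TemperedDistribution.fourier_apply, Lp.toTemperedDistribution_apply] at hdual
  rw [← hdual, SchwartzMap.fourier_coe]
  exact VectorFourier.integral_fourierIntegral_smul_eq_flip (L := innerₗ V)
    Real.continuous_fourierChar continuous_inner G.integrable hf |>.trans (by rw [flip_innerₗ]; rfl)

theorem coeFn_fourierInv_Lp_two (f : Lp F 2 (volume : Measure V)) (hf : Integrable f) :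
    (𝓕⁻ f : Lp F 2 (volume : Measure V)) =ᵐ[volume] 𝓕⁻ (f : V → F) := by
  refine ae_eq_of_integral_schwartzMap_smul_eq ((Lp.memLp _).locallyIntegrable (by norm_num))
    (continuous_fourierInv hf).locallyIntegrable fun G => ?_
  have hdual := congrArg (fun T => T G) (Lp.fourierInv_toTemperedDistribution_eq f)
  simp only [TemperedDistribution.fourierInv_apply, Lp.toTemperedDistribution_apply] at hdual
  have hflip : (-innerₗ V).flip = -innerₗ V := by
    ext
    simp [real_inner_comm]
  rw [← hdual, SchwartzMap.fourierInv_coe]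
  exact VectorFourier.integral_fourierIntegral_smul_eq_flip (L := -innerₗ V)
    Real.continuous_fourierChar (by exact continuous_inner.neg) G.integrable hf |>.trans
      (by rw [hflip]; rfl)

end FourierLp

section IsPrimitive

variable {E : Type*} [NormedAddCommGroup E] {u g u' g' : ℝ → E}

theorem locallyIntegrable_iff_intervalIntegrable :
    LocallyIntegrable g ↔ ∀ a b, IntervalIntegrable g volume a b := by
  refine ⟨fun h a b => (h.integrableOn_isCompact isCompact_uIcc).intervalIntegrable,
    fun h x => ⟨Icc (x - 1) (x + 1), Icc_mem_nhds (by linarith) (by linarith), ?_⟩⟩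
  exact (intervalIntegrable_iff_integrableOn_Icc_of_le (by linarith)).1 (h _ _)

variable [NormedSpace ℝ E]

theorem absolutelyContinuousOnInterval_of_dist_le_mul {X Y : Type*} [PseudoMetricSpace X]
    [PseudoMetricSpace Y] {f : ℝ → X} {g : ℝ → Y} {a b : ℝ}
    (hf : AbsolutelyContinuousOnInterval f a b) (K : ℝ)
    (hfg : ∀ x y, dist (g x) (g y) ≤ K * dist (f x) (f y)) :
    AbsolutelyContinuousOnInterval g a b := by
  refine squeeze_zero (fun t => Finset.sum_nonneg fun _ _ => dist_nonneg) (fun t => ?_)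
    (by simpa using Tendsto.const_mul K hf)
  rw [Finset.mul_sum]
  exact Finset.sum_le_sum fun _ _ => hfg _ _

/-- `u` is a primitive (indefinite integral) of the locally integrable function `g`; in contrast to
`deriv u = g`, this determines `u` up to a constant and `g` up to a null set. -/
structure IsPrimitive (u g : ℝ → E) : Prop where
  locallyIntegrable : LocallyIntegrable g
  sub_eq : ∀ x y, u y - u x = ∫ t in x..y, g t

namespace IsPrimitive

theorem intervalIntegrable (h : IsPrimitive u g) (a b : ℝ) : IntervalIntegrable g volume a b :=
  locallyIntegrable_iff_intervalIntegrable.1 h.locallyIntegrable a b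

theorem of_hasDerivAt [CompleteSpace E] (hu : ∀ x, HasDerivAt u (g x) x) (hg : Continuous g) :
    IsPrimitive u g where
  locallyIntegrable := hg.locallyIntegrable
  sub_eq x y := (intervalIntegral.integral_eq_sub_of_hasDerivAt (fun t _ => hu t)
    (hg.intervalIntegrable x y)).symm

theorem ae_hasDerivAt [CompleteSpace E] (h : IsPrimitive u g) : ∀ᵐ x, HasDerivAt u (g x) x := by
  have hu : u = fun y => (∫ t in (0 : ℝ)..y, g t) + u 0 := by
    ext y
    rw [← h.sub_eq, sub_add_cancel]
  filter_upwards [LocallyIntegrable.ae_hasDerivAt_integral h.locallyIntegrable] with x hx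
  rw [hu]
  exact (hx 0).add_const _

theorem locallyAC {u g : ℝ → ℂ} (h : IsPrimitive u g) : LocallyAC u := by
  intro a b
  have hnorm := fun a b => (h.intervalIntegrable a b).norm
  refine absolutelyContinuousOnInterval_of_dist_le_mul
    ((hnorm a b).absolutelyContinuousOnInterval_intervalIntegral left_mem_uIcc) 1 fun x y => ?_
  rw [one_mul, dist_comm, dist_eq_norm, h.sub_eq, dist_comm, Real.dist_eq,
    intervalIntegral.integral_interval_sub_left (hnorm _ _) (hnorm _ _)]
  exact intervalIntegral.norm_integral_le_abs_integral_norm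

theorem add (h : IsPrimitive u g) (h' : IsPrimitive u' g') :
    IsPrimitive (fun x => u x + u' x) (fun x => g x + g' x) where
  locallyIntegrable := h.locallyIntegrable.add h'.locallyIntegrable
  sub_eq x y := by
    rw [intervalIntegral.integral_add (h.intervalIntegrable _ _) (h'.intervalIntegrable _ _),
      ← h.sub_eq, ← h'.sub_eq]
    abel

theorem const_smul {𝕜 : Type*} [NormedField 𝕜] [NormedSpace 𝕜 E] [SMulCommClass ℝ 𝕜 E]
    (h : IsPrimitive u g) (c : 𝕜) : IsPrimitive (fun x => c • u x) (fun x => c • g x) where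
  locallyIntegrable := h.locallyIntegrable.smul c
  sub_eq x y := by rw [intervalIntegral.integral_smul, ← h.sub_eq, smul_sub]

theorem comp_mul (h : IsPrimitive u g) {k : ℝ} (hk : k ≠ 0) :
    IsPrimitive (fun x => u (k * x)) (fun x => k • g (k * x)) where
  locallyIntegrable := locallyIntegrable_iff_intervalIntegrable.2 fun a b => by
    have hi := (h.intervalIntegrable (k * a) (k * b)).comp_mul_left (c := k)
    rw [mul_div_cancel_left₀ _ hk, mul_div_cancel_left₀ _ hk] at hi
    exact hi.smul k
  sub_eq x y := by
    rw [intervalIntegral.integral_smul, intervalIntegral.smul_integral_comp_mul_left, h.sub_eq]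

theorem glue (h : IsPrimitive u g) (h' : IsPrimitive u' g') {c : ℝ} (hc : u c = u' c) :
    IsPrimitive (fun x => if x ≤ c then u x else u' x) (fun x => if x ≤ c then g x else g' x) := by
  set v := fun x : ℝ => if x ≤ c then u x else u' x with hv
  set k := fun x : ℝ => if x ≤ c then g x else g' x with hk
  have hki : ∀ a b, IntervalIntegrable k volume a b := by
    refine locallyIntegrable_iff_intervalIntegrable.1 ?_
    have hind : k = (Iic c).indicator g + (Ioi c).indicator g' := by
      ext x
      by_cases hx : x ≤ c
      · simp [hk, hx]
      · simp [hk, hx, not_le.1 hx]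
    rw [hind]
    exact (h.locallyIntegrable.indicator measurableSet_Iic).add
      (h'.locallyIntegrable.indicator measurableSet_Ioi)
  have hbase : ∀ y, v y - v c = ∫ t in c..y, k t := by
    intro y
    rcases le_or_gt y c with hy | hy
    · simp only [hv, hy, if_true, le_refl]
      rw [h.sub_eq]
      refine intervalIntegral.integral_congr fun t ht => ?_
      rw [uIcc_of_ge hy] at ht
      simp [hk, ht.2]
    · simp only [hv, not_le.2 hy, if_false, le_refl, if_true]
      rw [hc, h'.sub_eq]
      refine intervalIntegral.integral_congr_ae (Eventually.of_forall fun t ht => ?_)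
      rw [uIoc_of_le hy.le] at ht
      simp [hk, ht.1]
  refine ⟨locallyIntegrable_iff_intervalIntegrable.2 hki, fun x y => ?_⟩
  rw [← intervalIntegral.integral_interval_sub_left (hki c y) (hki c x), ← hbase, ← hbase]
  abel

end IsPrimitive

end IsPrimitive

section FourierInvReal

open scoped FourierTransform Real

theorem fourierInv_real_eq_integral_mul_exp (φ : ℝ → ℂ) (t : ℝ) :
    𝓕⁻ φ t = ∫ ξ : ℝ, φ ξ * Complex.exp ((2 * π * ξ * t : ℝ) * Complex.I) := by
  rw [Real.fourierInv_eq']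
  refine integral_congr_ae (Eventually.of_forall fun ξ => ?_)
  simp only [smul_eq_mul, RCLike.inner_apply, conj_trivial]
  rw [mul_comm, mul_comm t, ← mul_assoc]

theorem integrable_mul_exp {φ : ℝ → ℂ} (hφ : Integrable φ) (t : ℝ) :
    Integrable fun ξ => φ ξ * Complex.exp ((2 * π * ξ * t : ℝ) * Complex.I) :=
  hφ.mul_bdd (c := 1) (by fun_prop : Continuous fun ξ : ℝ =>
    Complex.exp ((2 * π * ξ * t : ℝ) * Complex.I)).aestronglyMeasurable
    (Eventually.of_forall fun _ => (Complex.norm_exp_ofReal_mul_I _).le)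

theorem isPrimitive_fourierInv {φ : ℝ → ℂ} (hφ : Integrable φ)
    (hφ' : Integrable fun ξ : ℝ => 2 * π * ξ * Complex.I * φ ξ) :
    IsPrimitive (𝓕⁻ φ) (𝓕⁻ fun ξ : ℝ => 2 * π * ξ * Complex.I * φ ξ) := by
  refine .of_hasDerivAt (fun t => ?_) (continuous_fourierInv hφ')
  have hmul : Integrable fun ξ : ℝ => ξ • φ ξ := by
    refine (hφ'.const_mul (2 * π * Complex.I)⁻¹).congr (Eventually.of_forall fun ξ => ?_)
    have := Complex.two_pi_I_ne_zero
    simp only [Complex.real_smul]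
    field_simp
  have hd := (Real.hasDerivAt_fourier hφ hmul (-t)).scomp t (hasDerivAt_neg t)
  rw [funext (Real.fourierInv_eq_fourier_neg φ), Real.fourierInv_eq_fourier_neg]
  convert! hd using 1
  simp only [Real.fourier_eq, neg_smul, one_smul, ← integral_neg]
  refine integral_congr_ae (Eventually.of_forall fun ξ => ?_)
  simp only [smul_eq_mul, ← smul_neg]
  congr 1
  ring

theorem two_pi_mul_conj_fourier_indicator_Ioc {a b : ℝ} (hab : a ≤ b) (ξ : ℝ) :
    2 * π * ξ * Complex.I * (starRingEnd ℂ) (𝓕 ((Ioc a b).indicator fun _ => (1 : ℂ)) ξ) =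
      Complex.exp ((2 * π * ξ * b : ℝ) * Complex.I) -
        Complex.exp ((2 * π * ξ * a : ℝ) * Complex.I) := by
  have hfourier : (starRingEnd ℂ) (𝓕 ((Ioc a b).indicator fun _ => (1 : ℂ)) ξ) =
      ∫ t in a..b, Complex.exp (2 * π * ξ * Complex.I * t) := by
    rw [Real.fourier_real_eq_integral_exp_smul, intervalIntegral.integral_of_le hab,
      ← integral_conj, ← integral_indicator measurableSet_Ioc]
    refine integral_congr_ae (Eventually.of_forall fun t => ?_)
    by_cases ht : t ∈ Ioc a b
    · simp only [indicator_of_mem ht, smul_eq_mul, mul_one, ← Complex.exp_conj, map_mul,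
        Complex.conj_ofReal, Complex.conj_I]
      push_cast
      ring_nf
    · simp [indicator_of_notMem ht]
  rw [hfourier]
  by_cases hξ : ξ = 0
  · simp [hξ]
  · have hc : (2 * π * ξ * Complex.I : ℂ) ≠ 0 := by simp [hξ, Real.pi_ne_zero]
    rw [integral_exp_mul_complex hc, mul_div_cancel₀ _ hc]
    push_cast
    ring_nf

theorem isPrimitive_coeFn_fourierInv_Lp_two {φ : ℝ → ℂ} (hφ : Integrable φ) {ψ : L2R}
    (hψ : ψ =ᵐ[volume] fun ξ : ℝ => 2 * π * ξ * Complex.I * φ ξ) :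
    IsPrimitive (𝓕⁻ φ) (𝓕⁻ ψ : L2R) := by
  refine ⟨(Lp.memLp (𝓕⁻ ψ : L2R)).locallyIntegrable (by norm_num), fun a b => ?_⟩
  wlog hab : a ≤ b generalizing a b with H
  · rw [intervalIntegral.integral_symm, ← H b a (le_of_not_ge hab), neg_sub]
  have hfin : volume (Ioc a b) ≠ ∞ := by simp
  set χ : L2R := indicatorConstLp 2 measurableSet_Ioc hfin (1 : ℂ) with hχ
  have hχc : χ =ᵐ[volume] (Ioc a b).indicator fun _ => (1 : ℂ) := indicatorConstLp_coeFn
  have hχi : Integrable χ :=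
    ((integrable_indicator_iff measurableSet_Ioc).2 (integrableOn_const hfin)).congr hχc.symm
  -- by Plancherel, the integral over `(a, b]` pairs `ψ` with the transform of the indicator
  have hinner : ∫ t in a..b, (𝓕⁻ ψ : L2R) t = inner ℂ (𝓕 χ : L2R) ψ := by
    rw [intervalIntegral.integral_of_le hab,
      ← L2.inner_indicatorConstLp_one measurableSet_Ioc hfin, ← hχ, ← Lp.inner_fourier_eq,
      FourierTransform.fourier_fourierInv_eq]
  rw [hinner, L2.inner_def, fourierInv_real_eq_integral_mul_exp,
    fourierInv_real_eq_integral_mul_exp,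
    ← integral_sub (integrable_mul_exp hφ b) (integrable_mul_exp hφ a)]
  refine integral_congr_ae ?_
  filter_upwards [coeFn_fourier_Lp_two χ hχi, hψ] with ξ hχξ hψξ
  rw [hχξ, hψξ, Real.fourier_congr_ae hχc, RCLike.inner_apply, ← mul_sub,
    ← two_pi_mul_conj_fourier_indicator_Ioc hab]
  ring

end FourierInvReal

/-! ### Weighted composition operators -/

section WeightedComp

variable {X Y 𝕜 : Type*} [MeasurableSpace X] [MeasurableSpace Y] [RCLike 𝕜] {μ : Measure X}
  {ν : Measure Y} {θ : X → Y} {w : X → 𝕜}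

theorem quasiMeasurePreserving_of_withDensity (hw : Measurable w) (hw0 : ∀ x, w x ≠ 0)
    (hθ : MeasurePreserving θ (μ.withDensity fun x => ‖w x‖ₑ ^ 2) ν) :
    Measure.QuasiMeasurePreserving θ μ ν :=
  hθ.quasiMeasurePreserving.mono_left (withDensity_absolutelyContinuous' (by fun_prop)
    (Eventually.of_forall fun x => by simpa using hw0 x))

theorem eLpNorm_two_mul_comp (hw : Measurable w)
    (hθ : MeasurePreserving θ (μ.withDensity fun x => ‖w x‖ₑ ^ 2) ν) (F : Lp 𝕜 2 ν) :
    eLpNorm (fun x => w x * F (θ x)) 2 μ = eLpNorm F 2 ν := by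
  have hF : Measurable fun y => ‖F y‖ₑ ^ 2 := (Lp.stronglyMeasurable F).measurable.enorm.pow_const _
  rw [eLpNorm_eq_lintegral_rpow_enorm_toReal two_ne_zero ENNReal.ofNat_ne_top,
    eLpNorm_eq_lintegral_rpow_enorm_toReal two_ne_zero ENNReal.ofNat_ne_top]
  simp only [ENNReal.toReal_ofNat, ENNReal.rpow_ofNat, enorm_mul, mul_pow]
  rw [← hθ.lintegral_comp hF, lintegral_withDensity_eq_lintegral_mul _ (by fun_prop)
    (show Measurable fun x => ‖F (θ x)‖ₑ ^ 2 from hF.comp hθ.measurable)]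
  rfl

theorem memLp_two_mul_comp (hw : Measurable w) (hw0 : ∀ x, w x ≠ 0)
    (hθ : MeasurePreserving θ (μ.withDensity fun x => ‖w x‖ₑ ^ 2) ν) (F : Lp 𝕜 2 ν) :
    MemLp (fun x => w x * F (θ x)) 2 μ :=
  ⟨hw.aestronglyMeasurable.mul ((Lp.aestronglyMeasurable F).comp_quasiMeasurePreserving
      (quasiMeasurePreserving_of_withDensity hw hw0 hθ)),
    by rw [eLpNorm_two_mul_comp hw hθ]; exact Lp.eLpNorm_lt_top F⟩

/-- The weighted composition operator `F ↦ w · (F ∘ θ)` as an isometry of `L²` spaces; it is one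
precisely because `θ` transports the measure `|w|² dμ` to `ν`. -/
noncomputable def weightedComp (hw : Measurable w) (hw0 : ∀ x, w x ≠ 0)
    (hθ : MeasurePreserving θ (μ.withDensity fun x => ‖w x‖ₑ ^ 2) ν) :
    Lp 𝕜 2 ν →ₗᵢ[𝕜] Lp 𝕜 2 μ where
  toFun F := (memLp_two_mul_comp hw hw0 hθ F).toLp _
  map_add' F G := by
    rw [← MemLp.toLp_add, MemLp.toLp_eq_toLp_iff]
    filter_upwards [(quasiMeasurePreserving_of_withDensity hw hw0 hθ).ae (Lp.coeFn_add F G)]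
      with x hx
    rw [hx, Pi.add_apply, Pi.add_apply, mul_add]
  map_smul' c F := by
    rw [RingHom.id_apply, ← MemLp.toLp_const_smul, MemLp.toLp_eq_toLp_iff]
    filter_upwards [(quasiMeasurePreserving_of_withDensity hw hw0 hθ).ae (Lp.coeFn_smul c F)]
      with x hx
    rw [hx, Pi.smul_apply, Pi.smul_apply, smul_eq_mul, smul_eq_mul, mul_left_comm]
  norm_map' F := by
    simp only [LinearMap.coe_mk, AddHom.coe_mk]
    rw [Lp.norm_toLp, eLpNorm_two_mul_comp hw hθ, Lp.norm_def]

theorem coeFn_weightedComp (hw : Measurable w) (hw0 : ∀ x, w x ≠ 0)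
    (hθ : MeasurePreserving θ (μ.withDensity fun x => ‖w x‖ₑ ^ 2) ν) (F : Lp 𝕜 2 ν) :
    weightedComp hw hw0 hθ F =ᵐ[μ] fun x => w x * F (θ x) :=
  (memLp_two_mul_comp hw hw0 hθ F).coeFn_toLp

end WeightedComp

section SkewRotation

variable {H : Type*} [NormedAddCommGroup H] [InnerProductSpace ℂ H] (J : H →ₗᵢ[ℂ] H)

theorem norm_smul_add_smul_of_apply_apply_eq_neg (hJ : ∀ F, J (J F) = -F) (x y : ℝ) (F : H) :
    ‖(x : ℂ) • F + (y : ℂ) • J F‖ ^ 2 = (x ^ 2 + y ^ 2) * ‖F‖ ^ 2 := by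
  have hskew : inner ℂ F (J F) = -inner ℂ (J F) F := by
    rw [← J.inner_map_map, hJ, inner_neg_right]
  have hre : (inner ℂ F (J F)).re = 0 := by
    have h := congrArg Complex.re hskew
    rw [Complex.neg_re, ← inner_conj_symm (J F) F, Complex.conj_re] at h
    linarith
  have hcross : RCLike.re (inner ℂ ((x : ℂ) • F) ((y : ℂ) • J F)) = 0 := by
    rw [inner_smul_left, inner_smul_right, Complex.conj_ofReal, ← mul_assoc, ← Complex.ofReal_mul]
    exact (Complex.re_ofReal_mul _ _).trans (by rw [hre, mul_zero])
  rw [norm_add_sq (𝕜 := ℂ), hcross, norm_smul, norm_smul, J.norm_map, Complex.norm_real,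
    Complex.norm_real, mul_pow, mul_pow, Real.norm_eq_abs, Real.norm_eq_abs, sq_abs, sq_abs]
  ring

/-- The rotation `x • F + y • J F` generated by an isometry `J` with `J² = -1`. -/
noncomputable def skewRotation (hJ : ∀ F, J (J F) = -F) (x y : ℝ) (hxy : x ^ 2 + y ^ 2 = 1) :
    H ≃ₗᵢ[ℂ] H :=
  have hc : (x : ℂ) ^ 2 + (y : ℂ) ^ 2 = 1 := by exact_mod_cast hxy
  have hinv : ∀ F : H, (x : ℂ) • (x : ℂ) • F + (y : ℂ) • (y : ℂ) • F = F := fun F => by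
    rw [smul_smul, smul_smul, ← add_smul, ← sq, ← sq, hc, one_smul]
  { toFun F := (x : ℂ) • F + (y : ℂ) • J F
    invFun F := (x : ℂ) • F - (y : ℂ) • J F
    map_add' F G := by
      simp only [map_add, smul_add]
      abel
    map_smul' c F := by simp only [map_smul, RingHom.id_apply, smul_add, smul_comm c]
    left_inv F := by
      simp only [map_add, map_smul, hJ]
      exact .trans (by module) (hinv F)
    right_inv F := by
      simp only [map_sub, map_smul, hJ]
      exact .trans (by module) (hinv F)
    norm_map' F := (sq_eq_sq₀ (norm_nonneg _) (norm_nonneg _)).1 <|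
      (norm_smul_add_smul_of_apply_apply_eq_neg J hJ x y F).trans (by rw [hxy, one_mul]) }

end SkewRotation

section Dilation

variable {α β : ℝ}

@[fun_prop]
theorem measurable_toyP (a b : ℝ) : Measurable (toyP a b) :=
  Measurable.ite measurableSet_Iic measurable_const measurable_const

theorem toyP_ne_zero {a b : ℝ} (ha : a ≠ 0) (hb : b ≠ 0) (x : ℝ) : toyP a b x ≠ 0 := by
  unfold toyP
  split_ifs <;> assumption

theorem div_nonpos_iff_nonpos_of_pos {x k : ℝ} (hk : 0 < k) : x / k ≤ 0 ↔ x ≤ 0 := by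
  rw [div_le_iff₀ hk, zero_mul]

/-- The travel time coordinate `x / √p(x)` when `p₋ = α⁴` and `p₊ = β⁴`. -/
noncomputable def travelTime (α β x : ℝ) : ℝ := x / toyP α β x ^ 2

@[fun_prop]
theorem measurable_travelTime (α β : ℝ) : Measurable (travelTime α β) := by
  unfold travelTime
  fun_prop

theorem travelTime_nonpos_iff (hα : α ≠ 0) (hβ : β ≠ 0) {x : ℝ} :
    travelTime α β x ≤ 0 ↔ x ≤ 0 :=
  div_nonpos_iff_nonpos_of_pos (sq_pos_of_ne_zero (toyP_ne_zero hα hβ x))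

theorem toyP_travelTime (hα : α ≠ 0) (hβ : β ≠ 0) (a b x : ℝ) :
    toyP a b (travelTime α β x) = toyP a b x := by
  simp only [toyP, travelTime_nonpos_iff hα hβ]

theorem travelTime_inv_travelTime (hα : α ≠ 0) (hβ : β ≠ 0) (x : ℝ) :
    travelTime α⁻¹ β⁻¹ (travelTime α β x) = x := by
  rw [travelTime, toyP_travelTime hα hβ, travelTime, toyP, toyP]
  split_ifs <;> field_simp

theorem setLIntegral_comp_div {k : ℝ} (hk : 0 < k) {s : Set ℝ} (hs : MeasurableSet s)
    (hsk : ∀ x, x / k ∈ s ↔ x ∈ s) {g : ℝ → ℝ≥0∞} (hg : Measurable g) :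
    ∫⁻ x in s, ENNReal.ofReal k⁻¹ * g (x / k) = ∫⁻ x in s, g x := by
  have hpre : (k⁻¹ * ·) ⁻¹' s = s := ext fun x => by
    rw [mem_preimage, inv_mul_eq_div, hsk]
  simp only [← inv_mul_eq_div k] at hsk ⊢
  rw [lintegral_const_mul _ (show Measurable fun x => g (k⁻¹ * x) by fun_prop)]
  conv_rhs => rw [← Real.smul_map_volume_mul_left (inv_pos.2 hk).ne']
  rw [Measure.restrict_smul, lintegral_smul_measure,
    setLIntegral_map hs hg (measurable_const_mul _), hpre, abs_of_pos (inv_pos.2 hk), smul_eq_mul]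

theorem measurePreserving_travelTime (hα : α ≠ 0) (hβ : β ≠ 0) :
    MeasurePreserving (travelTime α β)
      (volume.withDensity fun x => ‖((toyP α β x)⁻¹ : ℂ)‖ₑ ^ 2) volume := by
  have henorm : ∀ t : ℝ, ‖(t⁻¹ : ℂ)‖ₑ ^ 2 = ENNReal.ofReal (t ^ 2)⁻¹ := fun t => by
    rw [← ofReal_norm, ← ENNReal.ofReal_pow (norm_nonneg _), norm_inv, Complex.norm_real,
      Real.norm_eq_abs, inv_pow, sq_abs]
  have hα2 : 0 < α ^ 2 := by positivity
  have hβ2 : 0 < β ^ 2 := by positivity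
  refine ⟨by fun_prop, Measure.ext_of_lintegral _ fun g hg => ?_⟩
  rw [lintegral_map hg (by fun_prop), lintegral_withDensity_eq_lintegral_mul _ (by fun_prop)
      (show Measurable fun x => g (travelTime α β x) by fun_prop),
    ← lintegral_add_compl _ (measurableSet_Iic (a := (0 : ℝ))),
    ← lintegral_add_compl g (measurableSet_Iic (a := (0 : ℝ)))]
  congr 1
  · rw [← setLIntegral_comp_div hα2 measurableSet_Iic
      (fun x => by simp only [mem_Iic, div_nonpos_iff_nonpos_of_pos hα2]) hg]
    refine setLIntegral_congr_fun measurableSet_Iic fun x hx => ?_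
    simp only [Pi.mul_apply, travelTime, toyP, if_pos (mem_Iic.1 hx), henorm]
  · rw [← setLIntegral_comp_div hβ2 measurableSet_Iic.compl
      (fun x => by simp only [mem_compl_iff, mem_Iic, div_nonpos_iff_nonpos_of_pos hβ2]) hg]
    refine setLIntegral_congr_fun measurableSet_Iic.compl fun x hx => ?_
    simp only [Pi.mul_apply, travelTime, toyP, if_neg (show ¬x ≤ 0 from hx), henorm]

theorem inv_toyP_ne_zero (hα : α ≠ 0) (hβ : β ≠ 0) (x : ℝ) : ((toyP α β x)⁻¹ : ℂ) ≠ 0 :=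
  inv_ne_zero (Complex.ofReal_ne_zero.2 (toyP_ne_zero hα hβ x))

theorem quasiMeasurePreserving_travelTime (hα : α ≠ 0) (hβ : β ≠ 0) :
    Measure.QuasiMeasurePreserving (travelTime α β) volume volume :=
  quasiMeasurePreserving_of_withDensity (by fun_prop) (inv_toyP_ne_zero hα hβ)
    (measurePreserving_travelTime hα hβ)

/-- The change of variables `F ↦ p^{-1/4} · F(x / √p)` of `L²(ℝ)` for `p₋ = α⁴`, `p₊ = β⁴`, as an
isometry. -/
noncomputable def dilationIsometry (hα : α ≠ 0) (hβ : β ≠ 0) : L2R →ₗᵢ[ℂ] L2R :=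
  weightedComp (by fun_prop) (inv_toyP_ne_zero hα hβ) (measurePreserving_travelTime hα hβ)

theorem coeFn_dilationIsometry (hα : α ≠ 0) (hβ : β ≠ 0) (F : L2R) :
    dilationIsometry hα hβ F =ᵐ[volume]
      fun x => ((toyP α β x)⁻¹ : ℂ) * F (travelTime α β x) :=
  coeFn_weightedComp _ _ _ F

theorem dilationIsometry_dilationIsometry_inv (hα : α ≠ 0) (hβ : β ≠ 0) (F : L2R) :
    dilationIsometry hα hβ (dilationIsometry (inv_ne_zero hα) (inv_ne_zero hβ) F) = F := by
  refine Lp.ext ?_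
  filter_upwards [coeFn_dilationIsometry hα hβ
      (dilationIsometry (inv_ne_zero hα) (inv_ne_zero hβ) F),
    (quasiMeasurePreserving_travelTime hα hβ).ae
      (coeFn_dilationIsometry (inv_ne_zero hα) (inv_ne_zero hβ) F)] with x houter hinner
  have hinv : toyP α⁻¹ β⁻¹ x = (toyP α β x)⁻¹ := (apply_ite _ _ _ _).symm
  rw [houter, hinner, travelTime_inv_travelTime hα hβ, toyP_travelTime hα hβ, hinv,
    Complex.ofReal_inv, mul_inv_cancel_left₀ (inv_toyP_ne_zero hα hβ x)]

/-- The change of variables `F ↦ p^{-1/4} · F(x / √p)` of `L²(ℝ)` for `p₋ = α⁴`, `p₊ = β⁴`, as a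
unitary operator. -/
noncomputable def dilation (hα : α ≠ 0) (hβ : β ≠ 0) : L2R ≃ₗᵢ[ℂ] L2R :=
  LinearIsometryEquiv.ofSurjective (dilationIsometry hα hβ) fun F =>
    ⟨_, dilationIsometry_dilationIsometry_inv hα hβ F⟩

theorem coeFn_dilation (hα : α ≠ 0) (hβ : β ≠ 0) (F : L2R) :
    dilation hα hβ F =ᵐ[volume] fun x => ((toyP α β x)⁻¹ : ℂ) * F (travelTime α β x) :=
  coeFn_dilationIsometry hα hβ F

end Dilation

section OddReflection

theorem measurePreserving_neg_withDensity_sign :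
    MeasurePreserving (fun x : ℝ => -x)
      (volume.withDensity fun x => ‖(toyP (-1) 1 x : ℂ)‖ₑ ^ 2) volume := by
  have hone : (fun x => ‖(toyP (-1) 1 x : ℂ)‖ₑ ^ 2) = 1 := by
    ext x
    unfold toyP
    split_ifs <;> simp
  rw [hone, withDensity_one]
  exact Measure.measurePreserving_neg volume

/-- The odd reflection `F(t) ↦ sgn(t) F(-t)`, whose square is `-1`. -/
noncomputable def oddReflection : L2R →ₗᵢ[ℂ] L2R :=
  weightedComp (by fun_prop)
    (by simpa using toyP_ne_zero (neg_ne_zero.2 one_ne_zero) one_ne_zero)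
    measurePreserving_neg_withDensity_sign

theorem coeFn_oddReflection (F : L2R) :
    oddReflection F =ᵐ[volume] fun x => (toyP (-1) 1 x : ℂ) * F (-x) :=
  coeFn_weightedComp _ _ _ F

theorem oddReflection_oddReflection (F : L2R) : oddReflection (oddReflection F) = -F := by
  refine Lp.ext ?_
  filter_upwards [coeFn_oddReflection (oddReflection F),
    (Measure.measurePreserving_neg volume).quasiMeasurePreserving.ae (coeFn_oddReflection F),
    Lp.coeFn_neg F, volume.ae_ne 0] with x h1 h2 h3 hx
  rw [h1, h2, h3, Pi.neg_apply, neg_neg]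
  rcases lt_or_gt_of_ne hx with h | h <;> simp [toyP, h.le, not_le.2 h]

end OddReflection

/-! ### The unitary change of variables -/

section ToyUnitary

variable {α β : ℝ}

/-- The cosine of the rotation which makes `toyMap` produce functions `u` with `u` and `p u'`
continuous at `0`, when `p₋ = α⁴` and `p₊ = β⁴`. -/
noncomputable def rotCos (α β : ℝ) : ℝ := (α + β) / √(2 * (α ^ 2 + β ^ 2))

/-- The sine belonging to `rotCos`. -/
noncomputable def rotSin (α β : ℝ) : ℝ := (β - α) / √(2 * (α ^ 2 + β ^ 2))

theorem rotCos_sq_add_rotSin_sq (hα : 0 < α) (hβ : 0 < β) :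
    rotCos α β ^ 2 + rotSin α β ^ 2 = 1 := by
  rw [rotCos, rotSin, div_pow, div_pow, Real.sq_sqrt (by positivity)]
  field_simp
  ring

/-- The map turning the inverse Fourier transform into the expansion in generalized eigenfunctions
of `A_p` for `p₋ = α⁴`, `p₊ = β⁴`: the rotation by `rotCos`, `rotSin` generated by the odd
reflection, followed by the change of variables `dilation`. -/
noncomputable def toyMap (α β : ℝ) (F : ℝ → ℂ) (x : ℝ) : ℂ :=
  (toyP α β x : ℂ)⁻¹ * (rotCos α β * F (travelTime α β x) +
    rotSin α β * (toyP (-1) 1 x * F (-travelTime α β x)))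

theorem toyMap_congr_ae (hα : 0 < α) (hβ : 0 < β) {F G : ℝ → ℂ}
    (h : F =ᵐ[volume] G) : toyMap α β F =ᵐ[volume] toyMap α β G := by
  have htime := quasiMeasurePreserving_travelTime hα.ne' hβ.ne'
  have hneg := (Measure.measurePreserving_neg (volume : Measure ℝ)).quasiMeasurePreserving
  filter_upwards [htime.ae h, (hneg.comp htime).ae h] with x hx hx'
  rw [Function.comp_apply] at hx'
  rw [toyMap, toyMap, hx, hx']

/-- The unitary operator on `L²(ℝ)` given by `toyMap`. -/
noncomputable def toyUnitary (hα : 0 < α) (hβ : 0 < β) : L2R ≃ₗᵢ[ℂ] L2R :=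
  (skewRotation oddReflection oddReflection_oddReflection (rotCos α β) (rotSin α β)
    (rotCos_sq_add_rotSin_sq hα hβ)).trans (dilation hα.ne' hβ.ne')

theorem coeFn_toyUnitary (hα : 0 < α) (hβ : 0 < β) (F : L2R) :
    toyUnitary hα hβ F =ᵐ[volume] toyMap α β F := by
  have htime := quasiMeasurePreserving_travelTime hα.ne' hβ.ne'
  filter_upwards [coeFn_dilation hα.ne' hβ.ne'
      ((rotCos α β : ℂ) • F + (rotSin α β : ℂ) • oddReflection F),
    htime.ae (Lp.coeFn_add ((rotCos α β : ℂ) • F) ((rotSin α β : ℂ) • oddReflection F)),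
    htime.ae (Lp.coeFn_smul (rotCos α β : ℂ) F),
    htime.ae (Lp.coeFn_smul (rotSin α β : ℂ) (oddReflection F)),
    htime.ae (coeFn_oddReflection F)] with x hdil hadd hcos hsin hodd
  refine hdil.trans ?_
  rw [hadd, Pi.add_apply, hcos, hsin, Pi.smul_apply, Pi.smul_apply, hodd, smul_eq_mul, smul_eq_mul,
    toyP_travelTime hα.ne' hβ.ne', toyMap]

end ToyUnitary

/-! ### Injectivity of `A_p + 1` -/

section SturmLiouville

theorem le_of_ae_hasDerivAt_nonneg {f f' : ℝ → ℝ} {x y : ℝ} (hxy : x ≤ y)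
    (hf : AbsolutelyContinuousOnInterval f x y) (hd : ∀ᵐ t, HasDerivAt f (f' t) t)
    (h0 : ∀ t ∈ Icc x y, 0 ≤ f' t) : f x ≤ f y := by
  rw [← sub_nonneg, ← hf.integral_deriv_eq_sub]
  refine intervalIntegral.integral_nonneg_of_ae_restrict hxy
    ((ae_restrict_iff' measurableSet_Icc).2 ?_)
  filter_upwards [hd] with t ht htm
  rw [ht.deriv]
  exact h0 t htm

section Real

variable {p u v : ℝ → ℝ}

theorem ae_hasDerivAt_mul_of_sturmLiouville (hu' : ∀ᵐ x, HasDerivAt u (v x / p x) x)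
    (hv' : ∀ᵐ x, HasDerivAt v (u x) x) :
    ∀ᵐ x, HasDerivAt (u * v) (v x ^ 2 / p x + u x ^ 2) x := by
  filter_upwards [hu', hv'] with x hux hvx
  convert! hux.mul hvx using 1
  ring

theorem monotone_mul_of_sturmLiouville (hp : ∀ x, 0 < p x)
    (hu : ∀ a b, AbsolutelyContinuousOnInterval u a b)
    (hv : ∀ a b, AbsolutelyContinuousOnInterval v a b)
    (hu' : ∀ᵐ x, HasDerivAt u (v x / p x) x) (hv' : ∀ᵐ x, HasDerivAt v (u x) x) :
    Monotone (u * v) := fun x y hxy =>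
  le_of_ae_hasDerivAt_nonneg hxy ((hu x y).mul (hv x y))
    (ae_hasDerivAt_mul_of_sturmLiouville hu' hv') fun t _ => by
      have := hp t
      positivity

/- Where `u v` has a sign, `u²` is monotone because `(u²)' = 2 u v / p`, so `u²` stays away from `0`
on a half line. -/
theorem mul_eq_zero_of_sturmLiouville (hp : ∀ x, 0 < p x)
    (hu : ∀ a b, AbsolutelyContinuousOnInterval u a b)
    (hu' : ∀ᵐ x, HasDerivAt u (v x / p x) x) (hmono : Monotone (u * v))
    (hi : Integrable fun x => u x ^ 2) (x : ℝ) : u x * v x = 0 := by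
  have hsq : ∀ᵐ t, HasDerivAt (u * u) (2 * (u * v) t / p t) t := by
    filter_upwards [hu'] with t ht
    convert! ht.mul ht using 1
    rw [Pi.mul_apply]
    ring
  by_contra hne
  have hpos : 0 < u x ^ 2 := sq_pos_of_ne_zero (left_ne_zero_of_mul hne)
  have hfin := hi.measure_ge_lt_top hpos
  rcases lt_or_gt_of_ne hne with hlt | hgt
  · refine (measure_mono fun y (hy : y ≤ x) => ?_).not_gt (hfin.trans_eq Real.volume_Iic.symm)
    have hneg := le_of_ae_hasDerivAt_nonneg hy ((hu y x).mul (hu y x)).neg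
      (hsq.mono fun t ht => ht.neg) fun t ht => neg_nonneg.2 <|
        div_nonpos_of_nonpos_of_nonneg (by linarith [hmono ht.2, Pi.mul_apply u v x]) (hp t).le
    simpa [← sq] using hneg
  · refine (measure_mono fun y (hy : x ≤ y) => ?_).not_gt (hfin.trans_eq Real.volume_Ici.symm)
    have hle := le_of_ae_hasDerivAt_nonneg hy ((hu x y).mul (hu x y)) hsq fun t ht =>
      div_nonneg (by linarith [hmono ht.1, Pi.mul_apply u v x]) (hp t).le
    simpa [← sq] using hle

theorem ae_eq_zero_of_sturmLiouville (hp : ∀ x, 0 < p x)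
    (hu : ∀ a b, AbsolutelyContinuousOnInterval u a b)
    (hv : ∀ a b, AbsolutelyContinuousOnInterval v a b)
    (hu' : ∀ᵐ x, HasDerivAt u (v x / p x) x) (hv' : ∀ᵐ x, HasDerivAt v (u x) x)
    (hi : Integrable fun x => u x ^ 2) : u =ᵐ[volume] 0 := by
  have hzero : u * v = fun _ => 0 := funext <| mul_eq_zero_of_sturmLiouville hp hu hu'
    (monotone_mul_of_sturmLiouville hp hu hv hu' hv') hi
  filter_upwards [ae_hasDerivAt_mul_of_sturmLiouville hu' hv'] with x hx
  rw [hzero] at hx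
  have hsum : v x ^ 2 / p x + u x ^ 2 = 0 := hx.unique (hasDerivAt_const x 0)
  have hflux : 0 ≤ v x ^ 2 / p x := div_nonneg (sq_nonneg _) (hp x).le
  exact pow_eq_zero_iff two_ne_zero |>.1 (by linarith [sq_nonneg (u x)])

end Real

theorem LocallyAC.continuousLinearMap_comp {u : ℝ → ℂ} (hu : LocallyAC u) (L : ℂ →L[ℝ] ℝ)
    (a b : ℝ) : AbsolutelyContinuousOnInterval (fun x => L (u x)) a b :=
  absolutelyContinuousOnInterval_of_dist_le_mul (hu a b) ‖L‖ fun _ _ => L.dist_le_opNorm _ _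

theorem eq_zero_of_neg_mem_sturmLiouvilleGraph {p : ℝ → ℝ} (hp : ∀ x, 0 < p x) {f : L2R}
    (hf : (f, -f) ∈ sturmLiouvilleGraph p) : f = 0 := by
  obtain ⟨u, v, hu, hv, hfu, huv, hfv⟩ := hf
  have hmem : MemLp u 2 volume := (memLp_congr_ae hfu).1 (Lp.memLp f)
  have hpart : ∀ L : ℂ →L[ℝ] ℝ, ∀ᵐ x, L (u x) = 0 := by
    intro L
    refine ae_eq_zero_of_sturmLiouville (v := fun x => L (v x)) hp (hu.continuousLinearMap_comp L)
      (hv.continuousLinearMap_comp L) ?_ ?_ (hmem.continuousLinearMap_comp L).integrable_sq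
    · filter_upwards [huv, hu.ae_differentiableAt] with x hvx hdiff
      convert! L.hasFDerivAt.comp_hasDerivAt x hdiff.hasDerivAt using 1
      rw [hvx, ← Complex.real_smul, map_smul, smul_eq_mul, mul_div_cancel_left₀ _ (hp x).ne']
    · filter_upwards [hfu, hfv, Lp.coeFn_neg f, hv.ae_differentiableAt] with x hfx hfvx hneg hdiff
      convert! L.hasFDerivAt.comp_hasDerivAt x hdiff.hasDerivAt using 1
      rw [show u x = deriv v x from
        hfx.symm.trans (neg_injective (hneg.symm.trans hfvx))]
  refine Lp.eq_zero_iff_ae_eq_zero.2 ?_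
  filter_upwards [hfu, hpart Complex.reCLM, hpart Complex.imCLM] with x hfx hre him
  exact hfx.trans (Complex.ext hre him)

end SturmLiouville

/-! ### `A_p` as a multiplication operator -/

section Multiplication

theorem eq_of_add_eq_add_of_neg_mem {R M : Type*} [Ring R] [AddCommGroup M] [Module R M]
    {G : Submodule R (M × M)} (hG : ∀ f, (f, -f) ∈ G → f = 0) {a b : M × M} (ha : a ∈ G)
    (hb : b ∈ G) (hab : a.1 + a.2 = b.1 + b.2) : a = b := by
  have hsnd : (a - b).2 = -(a - b).1 := by
    rw [Prod.fst_sub, Prod.snd_sub, neg_sub, sub_eq_sub_iff_add_eq_add, add_comm, hab, add_comm]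
  have hfst : (a - b).1 = 0 := hG _ (by rw [← hsnd]; exact G.sub_mem ha hb)
  exact sub_eq_zero.1 (Prod.ext hfst (by rw [hsnd, hfst, neg_zero]; rfl))

variable {X 𝕜 : Type*} [MeasurableSpace X] {μ : Measure X} {m : X → ℝ} [RCLike 𝕜]

theorem exists_ae_eq_mul_add_eq {p : ℝ≥0∞} (hm : Measurable m) (hm0 : ∀ x, 0 ≤ m x)
    (χ : Lp 𝕜 p μ) : ∃ φ ψ : Lp 𝕜 p μ, ψ =ᵐ[μ] (fun x => (m x : 𝕜) * φ x) ∧ φ + ψ = χ := by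
  have hmem : MemLp (fun x => ((1 + m x)⁻¹ : ℝ) * χ x) p μ := by
    refine (Lp.memLp χ).of_le ((by fun_prop : Measurable fun x => (((1 + m x)⁻¹ : ℝ) : 𝕜)).mul
      (Lp.stronglyMeasurable χ).measurable).aestronglyMeasurable
      (Eventually.of_forall fun x => ?_)
    have hx := hm0 x
    rw [norm_mul, RCLike.norm_ofReal, abs_of_nonneg (by positivity)]
    exact mul_le_of_le_one_left (norm_nonneg _) (inv_le_one_of_one_le₀ (by linarith))
  refine ⟨hmem.toLp _, χ - hmem.toLp _, ?_, add_sub_cancel _ _⟩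
  filter_upwards [hmem.coeFn_toLp, Lp.coeFn_sub χ (hmem.toLp _)] with x hφ hψ
  have hx : (1 + m x : 𝕜) ≠ 0 := mod_cast (by linarith [hm0 x] : 1 + m x ≠ 0)
  rw [hψ, Pi.sub_apply, hφ]
  push_cast
  field_simp
  ring

theorem mem_iff_ae_eq_mul_of_forall_mem {H : Type*} [NormedAddCommGroup H] [InnerProductSpace ℂ H]
    {G : Submodule ℂ (H × H)} (hG : ∀ f, (f, -f) ∈ G → f = 0) (hm : Measurable m)
    (hm0 : ∀ x, 0 ≤ m x) (W : Lp ℂ 2 μ ≃ₗᵢ[ℂ] H)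
    (hW : ∀ φ ψ : Lp ℂ 2 μ, ψ =ᵐ[μ] (fun x => (m x : ℂ) * φ x) → (W φ, W ψ) ∈ G)
    (φ ψ : Lp ℂ 2 μ) : (W φ, W ψ) ∈ G ↔ ψ =ᵐ[μ] fun x => (m x : ℂ) * φ x := by
  refine ⟨fun h => ?_, hW φ ψ⟩
  obtain ⟨φ', ψ', hmul, hadd⟩ := exists_ae_eq_mul_add_eq hm hm0 (φ + ψ)
  have heq := eq_of_add_eq_add_of_neg_mem hG h (hW φ' ψ' hmul)
    (by rw [← map_add, ← map_add, hadd])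
  rwa [W.injective (congrArg Prod.fst heq), W.injective (congrArg Prod.snd heq)]

theorem integrable_mul_of_ae_eq_mul (hm : Measurable m) (hm0 : ∀ x, 0 ≤ m x)
    (hmi : Integrable (fun x => (1 + m x)⁻¹) μ) {φ ψ : Lp 𝕜 2 μ}
    (h : ψ =ᵐ[μ] fun x => (m x : 𝕜) * φ x) {k : X → 𝕜} (hk : Measurable k)
    (hkm : ∀ x, ‖k x‖ ^ 2 ≤ 1 + m x) : Integrable (fun x => k x * φ x) μ := by
  have hpos : ∀ x, 0 < 1 + m x := fun x => by linarith [hm0 x]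
  have hmeas : Measurable fun x => k x * ((1 + m x)⁻¹ : ℝ) := by fun_prop
  have hmem : MemLp (fun x => k x * ((1 + m x)⁻¹ : ℝ)) 2 μ := by
    refine (memLp_two_iff_integrable_sq_norm hmeas.aestronglyMeasurable).2 <|
      hmi.mono' (by fun_prop) (Eventually.of_forall fun x => ?_)
    have := hpos x
    rw [norm_pow, norm_norm, norm_mul, mul_pow, RCLike.norm_ofReal, sq_abs]
    calc ‖k x‖ ^ 2 * (1 + m x)⁻¹ ^ 2 ≤ (1 + m x) * (1 + m x)⁻¹ ^ 2 := by
          gcongr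
          exact hkm x
      _ = (1 + m x)⁻¹ := by field_simp
  refine (hmem.integrable_mul (Lp.memLp (φ + ψ))).congr ?_
  filter_upwards [h, Lp.coeFn_add φ ψ] with x hψ hadd
  have hx : (1 + m x : 𝕜) ≠ 0 := mod_cast (hpos x).ne'
  rw [Pi.mul_apply, hadd, Pi.add_apply, hψ]
  push_cast
  field_simp

end Multiplication

section ToyTransform

open scoped FourierTransform Real

variable {α β : ℝ}

/-- The symbol `(2πξ)²` of `-d²/dt²`. -/
noncomputable def freqSq (ξ : ℝ) : ℝ := (2 * π * ξ) ^ 2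

@[fun_prop]
theorem continuous_freqSq : Continuous freqSq := by
  unfold freqSq
  fun_prop

theorem freqSq_nonneg (ξ : ℝ) : 0 ≤ freqSq ξ := sq_nonneg _

theorem integrable_inv_one_add_freqSq : Integrable fun ξ => (1 + freqSq ξ)⁻¹ :=
  integrable_inv_one_add_sq.comp_mul_left' (by positivity)

theorem integrable_of_ae_eq_freqSq_mul {φ ψ : L2R}
    (h : ψ =ᵐ[volume] fun ξ => (freqSq ξ : ℂ) * φ ξ) : Integrable φ := by
  simpa using integrable_mul_of_ae_eq_mul continuous_freqSq.measurable freqSq_nonneg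
    integrable_inv_one_add_freqSq h (measurable_const (a := (1 : ℂ)))
    fun ξ => by simpa using freqSq_nonneg ξ

theorem integrable_two_pi_I_mul_of_ae_eq_freqSq_mul {φ ψ : L2R}
    (h : ψ =ᵐ[volume] fun ξ => (freqSq ξ : ℂ) * φ ξ) :
    Integrable fun ξ : ℝ => 2 * π * ξ * Complex.I * φ ξ := by
  refine integrable_mul_of_ae_eq_mul continuous_freqSq.measurable freqSq_nonneg
    integrable_inv_one_add_freqSq h (by fun_prop) fun ξ => ?_
  have hnorm : ‖(2 * π * ξ * Complex.I : ℂ)‖ = |2 * π * ξ| := by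
    rw [norm_mul, Complex.norm_I, mul_one, ← Real.norm_eq_abs, ← Complex.norm_real]
    push_cast
    rfl
  rw [hnorm, sq_abs, freqSq]
  linarith

theorem IsPrimitive.mul_comp_mul_add_mul_comp_neg_mul {u g : ℝ → ℂ} (h : IsPrimitive u g) {k : ℝ}
    (hk : k ≠ 0) (a b : ℂ) :
    IsPrimitive (fun x => a * u (k * x) + b * u (-k * x))
      (fun x => k * (a * g (k * x) - b * g (-k * x))) := by
  convert! ((h.comp_mul hk).const_smul a).add ((h.comp_mul (neg_ne_zero.2 hk)).const_smul b)
    using 2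
  rw [smul_eq_mul, smul_eq_mul, Complex.real_smul, Complex.real_smul]
  push_cast
  ring

theorem IsPrimitive.glue_mul_comp_mul_add {u g : ℝ → ℂ} (h : IsPrimitive u g) {k l : ℝ}
    (hk : k ≠ 0) (hl : l ≠ 0) {a b c d : ℂ} (hmatch : a + b = c + d) :
    IsPrimitive
      (fun x => if x ≤ 0 then a * u (k * x) + b * u (-k * x) else c * u (l * x) + d * u (-l * x))
      (fun x => if x ≤ 0 then k * (a * g (k * x) - b * g (-k * x))
        else l * (c * g (l * x) - d * g (-l * x))) :=
  (h.mul_comp_mul_add_mul_comp_neg_mul hk a b).glue (h.mul_comp_mul_add_mul_comp_neg_mul hl c d)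
    (by simp only [mul_zero, ← add_mul, hmatch])

/-- The expression `p u'` for `u = toyMap α β F`, in terms of `F'`. -/
noncomputable def toyFlux (α β : ℝ) (F : ℝ → ℂ) (x : ℝ) : ℂ :=
  toyP α β x * (rotCos α β * F (travelTime α β x) -
    rotSin α β * (toyP (-1) 1 x * F (-travelTime α β x)))

theorem inv_mul_rotCos_add_inv_mul_rotSin (hα : 0 < α) (hβ : 0 < β) :
    (α : ℂ)⁻¹ * rotCos α β + -(α : ℂ)⁻¹ * rotSin α β =
      (β : ℂ)⁻¹ * rotCos α β + (β : ℂ)⁻¹ * rotSin α β := by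
  have h : α⁻¹ * rotCos α β + -α⁻¹ * rotSin α β = β⁻¹ * rotCos α β + β⁻¹ * rotSin α β := by
    unfold rotCos rotSin
    field_simp
    ring
  exact_mod_cast h

theorem isPrimitive_toyMap (hα : 0 < α) (hβ : 0 < β) {F G : ℝ → ℂ} (hF : IsPrimitive F G) :
    IsPrimitive (toyMap α β F)
      fun x => (toyP (α ^ 4) (β ^ 4) x : ℂ)⁻¹ * toyFlux α β G x := by
  convert! hF.glue_mul_comp_mul_add (inv_ne_zero (pow_ne_zero 2 hα.ne'))
    (inv_ne_zero (pow_ne_zero 2 hβ.ne')) (inv_mul_rotCos_add_inv_mul_rotSin hα hβ) using 2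
    with x x
  all_goals
    simp only [toyMap, toyFlux, toyP, travelTime, div_eq_inv_mul, neg_mul]
    split_ifs
    all_goals
      push_cast
      field_simp
      try ring

theorem isPrimitive_toyFlux (hα : 0 < α) (hβ : 0 < β) {G K : ℝ → ℂ} (hG : IsPrimitive G K) :
    IsPrimitive (toyFlux α β G) (toyMap α β K) := by
  have hmatch : (α : ℂ) * rotCos α β + α * rotSin α β = β * rotCos α β + -β * rotSin α β := by
    have h : α * rotCos α β + α * rotSin α β = β * rotCos α β + -β * rotSin α β := by
      unfold rotCos rotSin
      ring
    exact_mod_cast h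
  convert! hG.glue_mul_comp_mul_add (inv_ne_zero (pow_ne_zero 2 hα.ne'))
    (inv_ne_zero (pow_ne_zero 2 hβ.ne')) hmatch using 2 with x x
  all_goals
    simp only [toyMap, toyFlux, toyP, travelTime, div_eq_inv_mul, neg_mul]
    split_ifs
    all_goals
      push_cast
      field_simp
      try ring

/-- The unitary operator that diagonalizes `A_p` for `p₋ = α⁴`, `p₊ = β⁴`. -/
noncomputable def toyTransform (hα : 0 < α) (hβ : 0 < β) : L2R ≃ₗᵢ[ℂ] L2R :=
  (Lp.fourierTransformₗᵢ ℝ ℂ).symm.trans (toyUnitary hα hβ)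

theorem coeFn_toyTransform (hα : 0 < α) (hβ : 0 < β) (φ : L2R) :
    toyTransform hα hβ φ =ᵐ[volume] toyMap α β (𝓕⁻ φ : L2R) :=
  coeFn_toyUnitary hα hβ _

theorem coeFn_toyTransform_of_integrable (hα : 0 < α) (hβ : 0 < β) {φ : L2R}
    (hφ : Integrable φ) : toyTransform hα hβ φ =ᵐ[volume] toyMap α β (𝓕⁻ (φ : ℝ → ℂ)) :=
  (coeFn_toyTransform hα hβ φ).trans (toyMap_congr_ae hα hβ (coeFn_fourierInv_Lp_two φ hφ))

theorem toyTransform_mem_sturmLiouvilleGraph (hα : 0 < α) (hβ : 0 < β) {φ ψ : L2R}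
    (h : ψ =ᵐ[volume] fun ξ => (freqSq ξ : ℂ) * φ ξ) :
    (toyTransform hα hβ φ, toyTransform hα hβ ψ) ∈
      sturmLiouvilleGraph (toyP (α ^ 4) (β ^ 4)) := by
  have hφ := integrable_of_ae_eq_freqSq_mul h
  have hφ' := integrable_two_pi_I_mul_of_ae_eq_freqSq_mul h
  have hψ : (-ψ : L2R) =ᵐ[volume]
      fun ξ : ℝ => 2 * π * ξ * Complex.I * (2 * π * ξ * Complex.I * φ ξ) := by
    filter_upwards [h, Lp.coeFn_neg ψ] with ξ hξ hneg
    rw [hneg, Pi.neg_apply, hξ, freqSq]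
    push_cast
    linear_combination (-4 * (π : ℂ) ^ 2 * ξ ^ 2 * φ ξ) * Complex.I_sq
  have hu := isPrimitive_toyMap hα hβ (isPrimitive_fourierInv hφ hφ')
  have hv := isPrimitive_toyFlux hα hβ (isPrimitive_coeFn_fourierInv_Lp_two hφ' hψ)
  refine ⟨_, _, hu.locallyAC, hv.locallyAC, coeFn_toyTransform_of_integrable hα hβ hφ, ?_, ?_⟩
  · filter_upwards [hu.ae_hasDerivAt] with x hx
    rw [hx.deriv, mul_inv_cancel_left₀]
    exact Complex.ofReal_ne_zero.2 (toyP_ne_zero (pow_pos hα 4).ne' (pow_pos hβ 4).ne' x)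
  · filter_upwards [hv.ae_hasDerivAt, coeFn_toyTransform hα hβ (-ψ),
      Lp.coeFn_neg (toyTransform hα hβ ψ)] with x hx hW hneg
    rw [hx.deriv, ← hW, map_neg, hneg, Pi.neg_apply, neg_neg]

theorem toyP_pos {a b : ℝ} (ha : 0 < a) (hb : 0 < b) (x : ℝ) : 0 < toyP a b x := by
  unfold toyP
  split_ifs <;> assumption

theorem toyTransform_mem_paleyWiener_iff (hα : 0 < α) (hβ : 0 < β) {s : Set ℝ}
    (hs : MeasurableSet s) (φ : L2R) :
    toyTransform hα hβ φ ∈ paleyWiener (sturmLiouville (toyP (α ^ 4) (β ^ 4))) s ↔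
      ∀ᵐ ξ, freqSq ξ ∉ s → φ ξ = 0 := by
  refine mem_paleyWiener_iff_of_mem_graph_iff _ continuous_freqSq.measurable (fun φ ψ => ?_) hs φ
  rw [sturmLiouville_graph]
  exact mem_iff_ae_eq_mul_of_forall_mem
    (fun _ => eq_zero_of_neg_mem_sturmLiouvilleGraph (toyP_pos (pow_pos hα 4) (pow_pos hβ 4)))
    continuous_freqSq.measurable freqSq_nonneg _
    (fun _ _ => toyTransform_mem_sturmLiouvilleGraph hα hβ) φ ψ

end ToyTransform

/-! ### Sampling in reproducing kernel Hilbert spaces -/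

section OrthogonalSystem

variable {ι 𝕜 H : Type*} [RCLike 𝕜] [NormedAddCommGroup H]
  [InnerProductSpace 𝕜 H] {v : ι → H} {c : ι → ℝ}

theorem orthogonal_span_sqrt_smul (hc : ∀ j, 0 < c j)
    (htotal : ∀ f : H, (∀ j, inner 𝕜 (v j) f = 0) → f = 0) :
    (Submodule.span 𝕜 (range fun j => (√(c j) : 𝕜) • v j))ᗮ = ⊥ := by
  rw [Submodule.eq_bot_iff]
  refine fun f hf => htotal f fun j => ?_
  have horth : inner 𝕜 ((√(c j) : 𝕜) • v j) f = 0 :=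
    (Submodule.mem_orthogonal _ _).1 hf _ (Submodule.subset_span ⟨j, rfl⟩)
  rw [inner_smul_left, RCLike.conj_ofReal] at horth
  exact (mul_eq_zero.1 horth).resolve_left
    (RCLike.ofReal_ne_zero.2 (Real.sqrt_pos.2 (hc j)).ne')

variable [DecidableEq ι]

theorem orthonormal_sqrt_smul (hc : ∀ j, 0 < c j)
    (hv : ∀ i j, inner 𝕜 (v i) (v j) = if i = j then ((c j : 𝕜))⁻¹ else 0) :
    Orthonormal 𝕜 fun j => (√(c j) : 𝕜) • v j := by
  rw [orthonormal_iff_ite]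
  intro i j
  rw [inner_smul_left, inner_smul_right, hv, RCLike.conj_ofReal]
  by_cases hij : i = j
  · subst hij
    have hci : (c i : 𝕜) ≠ 0 := RCLike.ofReal_ne_zero.2 (hc i).ne'
    rw [if_pos rfl, if_pos rfl, ← mul_assoc, ← RCLike.ofReal_mul, Real.mul_self_sqrt (hc i).le,
      mul_inv_cancel₀ hci]
  · rw [if_neg hij, if_neg hij, mul_zero, mul_zero]

variable [CompleteSpace H]

/-- The Hilbert basis obtained by normalizing a total orthogonal system `v` with
`‖v j‖ ^ 2 = (c j)⁻¹`. -/
noncomputable def hilbertBasisOfOrthogonal (hc : ∀ j, 0 < c j)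
    (hv : ∀ i j, inner 𝕜 (v i) (v j) = if i = j then ((c j : 𝕜))⁻¹ else 0)
    (htotal : ∀ f : H, (∀ j, inner 𝕜 (v j) f = 0) → f = 0) : HilbertBasis ι 𝕜 H :=
  HilbertBasis.mkOfOrthogonalEqBot (orthonormal_sqrt_smul hc hv)
    (orthogonal_span_sqrt_smul hc htotal)

variable (hc : ∀ j, 0 < c j)
  (hv : ∀ i j, inner 𝕜 (v i) (v j) = if i = j then ((c j : 𝕜))⁻¹ else 0)
  (htotal : ∀ f : H, (∀ j, inner 𝕜 (v j) f = 0) → f = 0)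

theorem hilbertBasisOfOrthogonal_apply (j : ι) :
    hilbertBasisOfOrthogonal hc hv htotal j = (√(c j) : 𝕜) • v j :=
  congrFun (HilbertBasis.coe_mkOfOrthogonalEqBot _ _) j

include hc hv htotal in
theorem hasSum_inner_smul_of_orthogonal (f : H) :
    HasSum (fun j => ((c j : 𝕜) * inner 𝕜 (v j) f) • v j) f := by
  convert! (hilbertBasisOfOrthogonal hc hv htotal).hasSum_repr f using 2 with j
  rw [HilbertBasis.repr_apply_apply, hilbertBasisOfOrthogonal_apply, inner_smul_left,
    RCLike.conj_ofReal, smul_smul, mul_right_comm, ← RCLike.ofReal_mul,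
    Real.mul_self_sqrt (hc j).le]

end OrthogonalSystem

namespace IsReproducingKernel

variable {V : Submodule ℂ L2R} {k : ℝ → ℝ → ℂ} (h : IsReproducingKernel V k)

/-- The element of `V` represented by the function `k x`. -/
noncomputable def kernelVec (x : ℝ) : V :=
  ⟨(h.kernel_mem x).2.choose, (h.kernel_mem x).2.choose_spec.1⟩

theorem coeFn_kernelVec (x : ℝ) : (h.kernelVec x : L2R) =ᵐ[volume] k x :=
  (h.kernel_mem x).2.choose_spec.2

theorem inner_kernelVec_eq_apply {u : ℝ → ℂ} (hu : Continuous u) {f : V}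
    (hfu : (f : L2R) =ᵐ[volume] u) (x : ℝ) : inner ℂ (h.kernelVec x) f = u x := by
  rw [h.reproducing u ⟨hu, f, f.2, hfu⟩ x, Submodule.coe_inner, L2.inner_def]
  refine integral_congr_ae ?_
  filter_upwards [hfu, h.coeFn_kernelVec x] with y hfy hky
  rw [hfy, hky, RCLike.inner_apply]

theorem inner_kernelVec_kernelVec (x y : ℝ) :
    inner ℂ (h.kernelVec x) (h.kernelVec y) = k y x :=
  h.inner_kernelVec_eq_apply (h.kernel_mem y).1 (h.coeFn_kernelVec y) x

theorem norm_kernelVec_sq (x : ℝ) : ‖h.kernelVec x‖ ^ 2 = ‖k x x‖ := by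
  have hself : (‖h.kernelVec x‖ ^ 2 : ℂ) = k x x :=
    (inner_self_eq_norm_sq_to_K _).symm.trans (h.inner_kernelVec_kernelVec x x)
  rw [← hself, norm_pow, Complex.norm_real, norm_norm]

include h in
theorem tendstoUniformly_of_tendsto {ι : Type*} {l : Filter ι} {F : ι → V} {f : V}
    (hlim : Tendsto F l (𝓝 f)) {U : ι → ℝ → ℂ} {u : ℝ → ℂ} (hU : ∀ i, Continuous (U i))
    (hFU : ∀ i, (F i : L2R) =ᵐ[volume] U i) (hu : Continuous u)
    (hfu : (f : L2R) =ᵐ[volume] u) {M : ℝ} (hM : ∀ x, ‖k x x‖ ≤ M) :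
    TendstoUniformly U u l := by
  have hbound : ∀ i x, dist (u x) (U i x) ≤ √M * dist f (F i) := fun i x => by
    have hsub : inner ℂ (h.kernelVec x) (f - F i) = u x - U i x := by
      rw [← h.inner_kernelVec_eq_apply hu hfu, ← h.inner_kernelVec_eq_apply (hU i) (hFU i)]
      exact inner_sub_right (𝕜 := ℂ) _ _ _
    rw [dist_eq_norm, dist_eq_norm, ← hsub]
    refine (norm_inner_le_norm (𝕜 := ℂ) (h.kernelVec x) (f - F i)).trans ?_
    gcongr
    exact Real.le_sqrt_of_sq_le ((h.norm_kernelVec_sq x).trans_le (hM x))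
  have hzero : Tendsto (fun i => √M * dist f (F i)) l (𝓝 0) := by
    simpa [dist_comm] using (tendsto_iff_dist_tendsto_zero.1 hlim).const_mul √M
  rw [Metric.tendstoUniformly_iff]
  intro ε hε
  filter_upwards [hzero.eventually_lt_const hε] with i hi x
  exact (hbound i x).trans_lt hi

theorem coeFn_smul_kernelVec (a : ℂ) (x : ℝ) :
    ((a • h.kernelVec x : V) : L2R) =ᵐ[volume] fun y => a * k x y := by
  filter_upwards [Lp.coeFn_smul a (h.kernelVec x : L2R), h.coeFn_kernelVec x] with y hsmul hky
  rw [Submodule.coe_smul, hsmul, Pi.smul_apply, hky, smul_eq_mul]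

theorem coeFn_sum_smul_kernelVec {ι : Type*} (s : Finset ι) (a : ι → ℂ) (x : ι → ℝ) :
    ((∑ j ∈ s, a j • h.kernelVec (x j) : V) : L2R) =ᵐ[volume]
      fun y => ∑ j ∈ s, a j * k (x j) y := by
  rw [Submodule.coe_sum]
  refine (Lp.coeFn_fun_finsetSum _ _).trans ?_
  filter_upwards [(Finset.eventually_all s).2 fun j _ => h.coeFn_smul_kernelVec (a j) (x j)]
    with y hy
  exact Finset.sum_congr rfl hy

section Sampling

variable {ι : Type*} {x : ι → ℝ} {c : ι → ℝ}

theorem eq_zero_of_inner_kernelVec_eq_zero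
    (huniq : ∀ u ∈ continuousElements V, (∀ j, u (x j) = 0) → u = 0) (f : V)
    (hf : ∀ j, inner ℂ (h.kernelVec (x j)) f = 0) : f = 0 := by
  obtain ⟨u, hu, hfu⟩ := h.exists_continuous f f.2
  have hzero : u = 0 := huniq u ⟨hu, f, f.2, hfu⟩ fun j => by
    rw [← h.inner_kernelVec_eq_apply hu hfu, hf]
  rw [hzero] at hfu
  exact Subtype.ext (Lp.eq_zero_iff_ae_eq_zero.2 hfu)

theorem inner_kernelVec_sampling [DecidableEq ι]
    (hk : ∀ i j, k (x i) (x j) = if i = j then (c j : ℂ)⁻¹ else 0) (i j : ι) :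
    inner ℂ (h.kernelVec (x i)) (h.kernelVec (x j)) = if i = j then (c j : ℂ)⁻¹ else 0 := by
  rw [h.inner_kernelVec_kernelVec, hk]
  split_ifs with hji hij <;> simp_all

variable [DecidableEq ι] [CompleteSpace V] (hc : ∀ j, 0 < c j)
  (hk : ∀ i j, k (x i) (x j) = if i = j then (c j : ℂ)⁻¹ else 0)
  (huniq : ∀ u ∈ continuousElements V, (∀ j, u (x j) = 0) → u = 0)

/-- The Hilbert basis of normalized kernel functions `√(c j) k (x j)`, for nodes `x j` at which the
kernel functions are orthogonal and which determine the elements of `V`. -/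
noncomputable def samplingBasis : HilbertBasis ι ℂ V :=
  hilbertBasisOfOrthogonal hc (h.inner_kernelVec_sampling hk)
    (h.eq_zero_of_inner_kernelVec_eq_zero huniq)

theorem coeFn_samplingBasis (j : ι) :
    (h.samplingBasis hc hk huniq j : L2R) =ᵐ[volume] fun y => √(c j) * k (x j) y := by
  rw [samplingBasis, hilbertBasisOfOrthogonal_apply]
  exact h.coeFn_smul_kernelVec _ _

include hc hk huniq in
theorem hasSum_sampling {u : ℝ → ℂ} (hu : Continuous u) {f : V}
    (hfu : (f : L2R) =ᵐ[volume] u) :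
    HasSum (fun j => (c j * u (x j)) • h.kernelVec (x j)) f := by
  convert! hasSum_inner_smul_of_orthogonal hc (h.inner_kernelVec_sampling hk)
    (h.eq_zero_of_inner_kernelVec_eq_zero huniq) f using 2 with j
  rw [h.inner_kernelVec_eq_apply hu hfu]
  rfl

include h hc hk huniq

theorem tendsto_eLpNorm_sampling {u : ℝ → ℂ} (hu : u ∈ continuousElements V) :
    Tendsto (fun s : Finset ι => eLpNorm
      (fun y => u y - ∑ j ∈ s, c j * u (x j) * k (x j) y) 2 volume) atTop (𝓝 0) := by
  obtain ⟨huc, f, hf, hfu⟩ := hu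
  have hsum : HasSum (fun j => (((c j * u (x j)) • h.kernelVec (x j) : V) : L2R)) f :=
    V.subtypeL.hasSum (h.hasSum_sampling hc hk huniq huc (f := ⟨f, hf⟩) hfu)
  refine ((Lp.tendsto_Lp_iff_tendsto_eLpNorm' _ _).1 hsum).congr fun s => ?_
  rw [← eLpNorm_neg, neg_sub]
  refine eLpNorm_congr_ae (hfu.sub ?_)
  simpa only [Submodule.coe_sum] using h.coeFn_sum_smul_kernelVec s (fun j => c j * u (x j)) x

theorem tendstoUniformly_sampling {u : ℝ → ℂ} (hu : u ∈ continuousElements V) {M : ℝ}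
    (hM : ∀ x, ‖k x x‖ ≤ M) :
    TendstoUniformly (fun (s : Finset ι) y => ∑ j ∈ s, c j * u (x j) * k (x j) y) u atTop := by
  obtain ⟨huc, f, hf, hfu⟩ := hu
  exact h.tendstoUniformly_of_tendsto (f := ⟨f, hf⟩) (h.hasSum_sampling hc hk huniq huc hfu)
    (fun s => continuous_finsetSum s fun j _ => continuous_const.mul (h.kernel_mem (x j)).1)
    (fun s => h.coeFn_sum_smul_kernelVec s _ x) huc hfu hM

end Sampling

end IsReproducingKernel

/-! ### The reproducing kernel -/

section Kernel

open scoped FourierTransform Real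

variable {α β Ω : ℝ}

theorem continuous_toyMap (hα : 0 < α) (hβ : 0 < β) {F : ℝ → ℂ} (hF : Continuous F) :
    Continuous (toyMap α β F) := by
  have hpiece : toyMap α β F = fun x => if x ≤ 0 then
      (α : ℂ)⁻¹ * rotCos α β * F (x / α ^ 2) + -(α : ℂ)⁻¹ * rotSin α β * F (-(x / α ^ 2))
      else (β : ℂ)⁻¹ * rotCos α β * F (x / β ^ 2) + (β : ℂ)⁻¹ * rotSin α β * F (-(x / β ^ 2)) := by
    ext x
    simp only [toyMap, toyP, travelTime]
    split_ifs <;> push_cast <;> ring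
  rw [hpiece]
  refine Continuous.if_le (by fun_prop) (by fun_prop) continuous_id continuous_const
    fun x (hx : x = 0) => ?_
  simp only [hx, zero_div, neg_zero, ← add_mul, inv_mul_rotCos_add_inv_mul_rotSin hα hβ]

theorem mul_toyMap (c : ℂ) (F : ℝ → ℂ) (x : ℝ) :
    c * toyMap α β F x = toyMap α β (fun t => c * F t) x := by
  unfold toyMap
  ring

theorem conj_toyMap (F : ℝ → ℂ) (x : ℝ) :
    (starRingEnd ℂ) (toyMap α β F x) = toyMap α β (fun t => (starRingEnd ℂ) (F t)) x := by
  simp only [toyMap, map_add, map_mul, map_inv₀, Complex.conj_ofReal]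

theorem toyMap_integral {X : Type*} [MeasurableSpace X] {μ : Measure X} {g : X → ℝ → ℂ}
    (hg : ∀ t, Integrable (fun ξ => g ξ t) μ) (x : ℝ) :
    toyMap α β (fun t => ∫ ξ, g ξ t ∂μ) x = ∫ ξ, toyMap α β (g ξ) x ∂μ := by
  unfold toyMap
  rw [integral_const_mul, integral_add ((hg _).const_mul _) (((hg _).const_mul _).const_mul _),
    integral_const_mul, integral_const_mul, integral_const_mul]

/-- The generalized eigenfunction of `A_p` at the point `x` with eigenvalue `(2πξ)²`, for
`p₋ = α⁴`, `p₊ = β⁴`. -/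
noncomputable def toyEigen (α β x ξ : ℝ) : ℂ :=
  toyMap α β (fun t => Complex.exp ((2 * π * ξ * t : ℝ) * Complex.I)) x

theorem continuous_toyEigen (α β x : ℝ) : Continuous (toyEigen α β x) := by
  unfold toyEigen toyMap
  fun_prop

theorem toyMap_fourierInv {φ : ℝ → ℂ} (hφ : Integrable φ) (x : ℝ) :
    toyMap α β (𝓕⁻ φ) x = ∫ ξ, φ ξ * toyEigen α β x ξ := by
  rw [funext fun t => fourierInv_real_eq_integral_mul_exp φ t,
    toyMap_integral fun t => integrable_mul_exp hφ t]
  simp only [toyEigen, mul_toyMap]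

/-- The frequency band `{ξ : (2πξ)² ≤ Ω}`. -/
def band (Ω : ℝ) : Set ℝ := Icc (-(√Ω / (2 * π))) (√Ω / (2 * π))

theorem measurableSet_band : MeasurableSet (band Ω) := measurableSet_Icc

theorem freqSq_mem_Icc_iff (hΩ : 0 < Ω) (ξ : ℝ) : freqSq ξ ∈ Icc 0 Ω ↔ ξ ∈ band Ω := by
  have h2 : (0 : ℝ) < 2 * π := by positivity
  rw [mem_Icc, band, mem_Icc, and_iff_right (freqSq_nonneg ξ), freqSq, Real.sq_le hΩ.le,
    ← neg_div, div_le_iff₀ h2, le_div_iff₀ h2, mul_comm ξ]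

/-- The functions supported, up to a null set, in the band of frequencies with `(2πξ)² ≤ Ω`. -/
def IsBandLimited (Ω : ℝ) (φ : ℝ → ℂ) : Prop := ∀ᵐ ξ, ξ ∉ band Ω → φ ξ = 0

theorem IsBandLimited.integrable {φ : L2R} (hφ : IsBandLimited Ω φ) : Integrable φ := by
  have hband : IntegrableOn φ (band Ω) := integrableOn_Lp_of_measure_ne_top φ
    fact_one_le_two_ennreal.elim measure_Icc_lt_top.ne
  refine ((integrable_indicator_iff measurableSet_band).2 hband).congr ?_
  filter_upwards [hφ] with ξ hξ
  exact indicator_apply_eq_self.2 hξ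

theorem memLp_indicator_band {g : ℝ → ℂ} (hg : Continuous g) :
    MemLp ((band Ω).indicator g) 2 volume :=
  (memLp_indicator_iff_restrict measurableSet_band).2 <|
    (memLp_two_iff_integrable_sq_norm hg.aestronglyMeasurable).2
      (hg.norm.pow 2).integrableOn_Icc

/-- The coordinates of the reproducing kernel at `x` with respect to the generalized
eigenfunctions. -/
noncomputable def toyKernelVec (α β Ω x : ℝ) : L2R :=
  (memLp_indicator_band (Ω := Ω)
    (Complex.continuous_conj.comp (continuous_toyEigen α β x))).toLp _

theorem coeFn_toyKernelVec (α β Ω x : ℝ) : toyKernelVec α β Ω x =ᵐ[volume]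
    (band Ω).indicator fun ξ => (starRingEnd ℂ) (toyEigen α β x ξ) :=
  MemLp.coeFn_toLp _

theorem isBandLimited_toyKernelVec (α β Ω x : ℝ) : IsBandLimited Ω (toyKernelVec α β Ω x) := by
  filter_upwards [coeFn_toyKernelVec α β Ω x] with ξ h hξ
  rw [h, indicator_of_notMem hξ]

theorem inner_toyKernelVec {φ : L2R} (hφ : IsBandLimited Ω φ) (x : ℝ) :
    inner ℂ (toyKernelVec α β Ω x) φ = toyMap α β (𝓕⁻ (φ : ℝ → ℂ)) x := by
  rw [toyMap_fourierInv hφ.integrable, L2.inner_def]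
  refine integral_congr_ae ?_
  filter_upwards [hφ, coeFn_toyKernelVec α β Ω x] with ξ hξ hvec
  rw [hvec, RCLike.inner_apply]
  by_cases hmem : ξ ∈ band Ω
  · rw [indicator_of_mem hmem, Complex.conj_conj]
  · rw [hξ hmem, zero_mul, zero_mul]

theorem integral_band_exp (hΩ : 0 < Ω) (t : ℝ) :
    ∫ ξ in band Ω, Complex.exp ((2 * π * ξ * t : ℝ) * Complex.I) =
      ((√Ω / π * Real.sinc (√Ω * t) : ℝ) : ℂ) := by
  have hsqrt : √Ω ≠ 0 := (Real.sqrt_pos.2 hΩ).ne'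
  have hle : -(√Ω / (2 * π)) ≤ √Ω / (2 * π) := neg_le_self (by positivity)
  rw [band, integral_Icc_eq_integral_Ioc, ← intervalIntegral.integral_of_le hle]
  rcases eq_or_ne t 0 with rfl | ht
  · simp only [mul_zero, Complex.ofReal_zero, zero_mul, Complex.exp_zero, Real.sinc_zero, mul_one,
      intervalIntegral.integral_const, Complex.real_smul]
    push_cast
    field_simp
    ring
  · have hscale : ∀ ξ : ℝ, Complex.exp ((2 * π * ξ * t : ℝ) * Complex.I) =
        Complex.exp ((2 * π * t * ξ : ℝ) * Complex.I) := fun ξ => by rw [mul_right_comm]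
    have hend : 2 * π * t * (√Ω / (2 * π)) = √Ω * t := by field_simp
    simp only [hscale]
    rw [intervalIntegral.integral_comp_mul_left (fun ξ : ℝ => Complex.exp (ξ * Complex.I))
      (by positivity : 2 * π * t ≠ 0), mul_neg, hend, integral_exp_mul_I_eq_sinc, Complex.real_smul]
    have ht' : (t : ℂ) ≠ 0 := Complex.ofReal_ne_zero.2 ht
    push_cast
    field_simp

theorem fourierInv_toyKernelVec (hΩ : 0 < Ω) (x s : ℝ) :
    𝓕⁻ (toyKernelVec α β Ω x : ℝ → ℂ) s =
      toyMap α β (fun t => ((√Ω / π * Real.sinc (√Ω * (s - t)) : ℝ) : ℂ)) x := by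
  have hint : ∀ t, Integrable (fun ξ : ℝ => Complex.exp ((2 * π * ξ * (s - t) : ℝ) * Complex.I))
      (volume.restrict (band Ω)) := fun t =>
    (by fun_prop : Continuous fun ξ : ℝ =>
      Complex.exp ((2 * π * ξ * (s - t) : ℝ) * Complex.I)).integrableOn_Icc
  have heigen : ∀ ξ : ℝ, toyMap α β
      (fun t => Complex.exp ((2 * π * ξ * (s - t) : ℝ) * Complex.I)) x =
        (starRingEnd ℂ) (toyEigen α β x ξ) * Complex.exp ((2 * π * ξ * s : ℝ) * Complex.I) := by
    intro ξ
    rw [toyEigen, conj_toyMap, mul_comm (toyMap _ _ _ _), mul_toyMap]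
    congr 1 with t
    rw [← Complex.exp_conj, ← Complex.exp_add, map_mul, Complex.conj_ofReal, Complex.conj_I]
    push_cast
    ring_nf
  simp only [← integral_band_exp hΩ]
  rw [toyMap_integral hint, fourierInv_real_eq_integral_mul_exp,
    ← integral_indicator measurableSet_band]
  refine integral_congr_ae ?_
  filter_upwards [coeFn_toyKernelVec α β Ω x] with ξ hvec
  simp only [hvec, heigen, indicator_mul_left]

theorem toyMap_toyMap_of_even {g : ℝ → ℂ} (hg : ∀ t, g (-t) = g t) (x y : ℝ) :
    toyMap α β (fun s => toyMap α β (fun t => g (s - t)) x) y =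
      (toyP α β x : ℂ)⁻¹ * (toyP α β y : ℂ)⁻¹ *
        ((rotCos α β ^ 2 + toyP (-1) 1 x * toyP (-1) 1 y * rotSin α β ^ 2) *
            g (travelTime α β x - travelTime α β y) +
          (toyP (-1) 1 x + toyP (-1) 1 y) * (rotCos α β * rotSin α β) *
            g (travelTime α β x + travelTime α β y)) := by
  have hdiff : g (travelTime α β y - travelTime α β x) =
      g (travelTime α β x - travelTime α β y) := by rw [← hg, neg_sub]
  have hsum : g (-travelTime α β y - travelTime α β x) =
      g (travelTime α β x + travelTime α β y) := by rw [← hg]; ring_nf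
  simp only [toyMap, hsum, hdiff, sub_neg_eq_add, neg_add_eq_sub,
    add_comm (travelTime α β y) (travelTime α β x)]
  ring

theorem sqrt_pow_four (hα : 0 < α) : √(α ^ 4) = α ^ 2 := by
  rw [show α ^ 4 = (α ^ 2) ^ 2 by ring, Real.sqrt_sq (by positivity)]

theorem rotCos_mul_rotSin (hα : 0 < α) (hβ : 0 < β) :
    rotCos α β * rotSin α β = (β ^ 2 - α ^ 2) / (2 * (β ^ 2 + α ^ 2)) := by
  rw [rotSin, rotCos, div_mul_div_comm, Real.mul_self_sqrt (by positivity)]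
  ring

theorem rotCos_sq_sub_rotSin_sq (hα : 0 < α) (hβ : 0 < β) :
    rotCos α β ^ 2 - rotSin α β ^ 2 = 2 * α * β / (β ^ 2 + α ^ 2) := by
  rw [rotCos, rotSin, div_pow, div_pow, Real.sq_sqrt (by positivity)]
  field_simp
  ring

theorem toyKernel_eq (hα : 0 < α) (hβ : 0 < β) (x y : ℝ) :
    toyKernel (α ^ 4) (β ^ 4) Ω x y =
      (√Ω / π / (toyP α β x * toyP α β y) *
        ((rotCos α β ^ 2 + toyP (-1) 1 x * toyP (-1) 1 y * rotSin α β ^ 2) *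
            Real.sinc (√Ω * (travelTime α β x - travelTime α β y)) +
          (toyP (-1) 1 x + toyP (-1) 1 y) * (rotCos α β * rotSin α β) *
            Real.sinc (√Ω * (travelTime α β x + travelTime α β y))) : ℝ) := by
  have hone := rotCos_sq_add_rotSin_sq hα hβ
  have hdiff := rotCos_sq_sub_rotSin_sq hα hβ
  rw [toyKernel, sqrt_pow_four hα, sqrt_pow_four hβ, rotCos_mul_rotSin hα hβ]
  congr 1
  simp only [toyP, travelTime]
  split_ifs
  · rw [sub_div, add_div, neg_one_mul, neg_neg, one_mul, hone]
    field_simp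
    ring
  · rw [neg_one_mul, neg_one_mul, ← sub_eq_add_neg, hdiff]
    field_simp
    ring
  · rw [one_mul, neg_one_mul, ← sub_eq_add_neg, hdiff]
    field_simp
    ring
  · rw [sub_div, add_div, one_mul, one_mul, hone]
    field_simp
    ring

theorem toyMap_fourierInv_toyKernelVec (hα : 0 < α) (hβ : 0 < β) (hΩ : 0 < Ω) (x y : ℝ) :
    toyMap α β (𝓕⁻ (toyKernelVec α β Ω x : ℝ → ℂ)) y = toyKernel (α ^ 4) (β ^ 4) Ω x y := by
  rw [funext (fourierInv_toyKernelVec hΩ x), toyMap_toyMap_of_even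
    (g := fun t => ((√Ω / π * Real.sinc (√Ω * t) : ℝ) : ℂ)) (by simp), toyKernel_eq hα hβ]
  push_cast
  field_simp

/-- The Paley–Wiener space `PW_{[0,Ω]}(A_p)` for `p₋ = α⁴`, `p₊ = β⁴`. -/
noncomputable abbrev toyPaleyWiener (α β Ω : ℝ) : Submodule ℂ L2R :=
  paleyWiener (sturmLiouville (toyP (α ^ 4) (β ^ 4))) (Icc 0 Ω)

theorem toyTransform_mem_toyPaleyWiener_iff (hα : 0 < α) (hβ : 0 < β) (hΩ : 0 < Ω) (φ : L2R) :
    toyTransform hα hβ φ ∈ toyPaleyWiener α β Ω ↔ IsBandLimited Ω φ := by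
  rw [toyTransform_mem_paleyWiener_iff hα hβ measurableSet_Icc, IsBandLimited]
  simp only [freqSq_mem_Icc_iff hΩ]

theorem toyMap_fourierInv_mem_continuousElements (hα : 0 < α) (hβ : 0 < β) (hΩ : 0 < Ω) {φ : L2R}
    (hφ : IsBandLimited Ω φ) :
    toyMap α β (𝓕⁻ (φ : ℝ → ℂ)) ∈ continuousElements (toyPaleyWiener α β Ω) :=
  ⟨continuous_toyMap hα hβ (continuous_fourierInv hφ.integrable), toyTransform hα hβ φ,
    (toyTransform_mem_toyPaleyWiener_iff hα hβ hΩ φ).2 hφ,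
    coeFn_toyTransform_of_integrable hα hβ hφ.integrable⟩

theorem exists_isBandLimited_of_mem_toyPaleyWiener (hα : 0 < α) (hβ : 0 < β) (hΩ : 0 < Ω)
    {f : L2R} (hf : f ∈ toyPaleyWiener α β Ω) :
    ∃ φ : L2R, IsBandLimited Ω φ ∧ toyTransform hα hβ φ = f := by
  obtain ⟨φ, rfl⟩ := (toyTransform hα hβ).surjective f
  exact ⟨φ, (toyTransform_mem_toyPaleyWiener_iff hα hβ hΩ φ).1 hf, rfl⟩

theorem exists_isBandLimited_of_mem_continuousElements (hα : 0 < α) (hβ : 0 < β) (hΩ : 0 < Ω)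
    {u : ℝ → ℂ} (hu : u ∈ continuousElements (toyPaleyWiener α β Ω)) :
    ∃ φ : L2R, IsBandLimited Ω φ ∧ toyMap α β (𝓕⁻ (φ : ℝ → ℂ)) = u := by
  obtain ⟨huc, f, hf, hfu⟩ := hu
  obtain ⟨φ, hφ, rfl⟩ := exists_isBandLimited_of_mem_toyPaleyWiener hα hβ hΩ hf
  exact ⟨φ, hφ, Measure.eq_of_ae_eq (μ := volume)
    ((coeFn_toyTransform_of_integrable hα hβ hφ.integrable).symm.trans hfu)
    (continuous_toyMap hα hβ (continuous_fourierInv hφ.integrable)) huc⟩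

theorem isReproducingKernel_toyKernel (hα : 0 < α) (hβ : 0 < β) (hΩ : 0 < Ω) :
    IsReproducingKernel (toyPaleyWiener α β Ω) (toyKernel (α ^ 4) (β ^ 4) Ω) where
  exists_continuous f hf := by
    obtain ⟨φ, hφ, rfl⟩ := exists_isBandLimited_of_mem_toyPaleyWiener hα hβ hΩ hf
    exact ⟨_, (toyMap_fourierInv_mem_continuousElements hα hβ hΩ hφ).1,
      coeFn_toyTransform_of_integrable hα hβ hφ.integrable⟩
  kernel_mem x := by
    rw [← funext (toyMap_fourierInv_toyKernelVec hα hβ hΩ x)]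
    exact toyMap_fourierInv_mem_continuousElements hα hβ hΩ (isBandLimited_toyKernelVec α β Ω x)
  reproducing u hu x := by
    obtain ⟨φ, hφ, rfl⟩ := exists_isBandLimited_of_mem_continuousElements hα hβ hΩ hu
    rw [← inner_toyKernelVec hφ, ← (toyTransform hα hβ).inner_map_map, L2.inner_def]
    refine integral_congr_ae ?_
    filter_upwards [coeFn_toyTransform_of_integrable hα hβ hφ.integrable,
      coeFn_toyTransform_of_integrable hα hβ (isBandLimited_toyKernelVec α β Ω x).integrable]
      with y hu hk
    rw [hu, hk, toyMap_fourierInv_toyKernelVec hα hβ hΩ, RCLike.inner_apply]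

theorem norm_toyKernel_self_le (a b x : ℝ) : ‖toyKernel a b Ω x x‖ ≤
    (1 + |(√b - √a) / (√b + √a)|) * (√Ω / (π * √a) + √Ω / (π * √b)) := by
  have hsinc : ∀ c r s t : ℝ, 0 ≤ c → |c * Real.sinc s + r * c * Real.sinc t| ≤ (1 + |r|) * c := by
    intro c r s t hc
    refine (abs_add_le _ _).trans ?_
    rw [abs_mul, abs_mul, abs_mul, abs_of_nonneg hc, add_mul, one_mul]
    exact add_le_add (mul_le_of_le_one_right hc (Real.abs_sinc_le_one s))
      (mul_le_of_le_one_right (by positivity) (Real.abs_sinc_le_one t))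
  rw [toyKernel, Complex.norm_real, Real.norm_eq_abs]
  split_ifs
  · rw [sub_eq_add_neg, ← neg_mul, ← neg_mul]
    refine (hsinc _ _ _ _ (by positivity)).trans ?_
    rw [abs_neg]
    gcongr
    exact le_add_of_nonneg_right (by positivity)
  · refine (hsinc _ _ _ _ (by positivity)).trans ?_
    gcongr
    exact le_add_of_nonneg_left (by positivity)

end Kernel

/-! ### The sampling points -/

section Shannon

open scoped FourierTransform Real

variable {a b : ℝ}

theorem fourierCoeffOn_eq_fourierInv (hab : a < b) {φ : ℝ → ℂ}
    (hφ : ∀ᵐ ξ, ξ ∉ Icc a b → φ ξ = 0) (n : ℤ) :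
    fourierCoeffOn hab φ n = (1 / (b - a)) • 𝓕⁻ φ ((-n : ℤ) / (b - a)) := by
  rw [fourierCoeffOn_eq_integral, intervalIntegral.integral_of_le hab.le,
    ← integral_Icc_eq_integral_Ioc, ← integral_indicator measurableSet_Icc,
    fourierInv_real_eq_integral_mul_exp]
  congr 1
  refine integral_congr_ae ?_
  filter_upwards [hφ] with ξ hξ
  by_cases hmem : ξ ∈ Icc a b
  · rw [indicator_of_mem hmem, fourier_coe_apply, smul_eq_mul, mul_comm]
    congr 2
    push_cast
    ring
  · rw [indicator_of_notMem hmem, hξ hmem, zero_mul]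

theorem eq_zero_of_fourierInv_intCast_div_eq_zero (hab : a < b) {φ : Lp ℂ 2 (volume : Measure ℝ)}
    (hφ : ∀ᵐ ξ, ξ ∉ Icc a b → φ ξ = 0)
    (h0 : ∀ n : ℤ, 𝓕⁻ (φ : ℝ → ℂ) (n / (b - a)) = 0) : φ = 0 := by
  have hparseval := hasSum_sq_fourierCoeffOn hab ((Lp.memLp φ).restrict _)
  simp only [fourierCoeffOn_eq_fourierInv hab hφ, h0, smul_zero, norm_zero,
    zero_pow two_ne_zero] at hparseval
  have hnorm : (b - a)⁻¹ • ‖φ‖ ^ 2 = 0 := by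
    rw [← hparseval.unique hasSum_zero, norm_sq_Lp_two, intervalIntegral.integral_of_le hab.le,
      ← integral_Icc_eq_integral_Ioc, setIntegral_eq_integral_of_ae_compl_eq_zero]
    filter_upwards [hφ] with ξ hξ hmem
    rw [hξ hmem, norm_zero, zero_pow two_ne_zero]
  simpa [(sub_pos.2 hab).ne'] using hnorm

end Shannon

section SamplingPoints

open scoped FourierTransform Real

variable {α β Ω : ℝ}

theorem sinc_pi_mul_intCast (n : ℤ) : Real.sinc (π * n) = if n = 0 then 1 else 0 := by
  split_ifs with h
  · simp [h]
  · rw [Real.sinc_of_ne_zero (mul_ne_zero Real.pi_ne_zero (by exact_mod_cast h)), mul_comm π,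
      Real.sin_int_mul_pi, zero_div]

theorem sq_toyP_neg_one_one (x : ℝ) : toyP (-1) 1 x ^ 2 = 1 := by
  unfold toyP
  split_ifs <;> norm_num

theorem toyP_neg_one_one_neg {x : ℝ} (hx : x ≠ 0) : toyP (-1) 1 (-x) = -toyP (-1) 1 x := by
  rcases hx.lt_or_gt with h | h
  · simp [toyP, h.le, not_le.2 h]
  · simp [toyP, h.le, not_le.2 h]

theorem toyWeight_pos {a b : ℝ} (ha : 0 < a) (hb : 0 < b) (j : ℤ) : 0 < toyWeight a b j := by
  unfold toyWeight
  split_ifs <;> positivity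

theorem toyPoint_nonpos_iff {a b : ℝ} (ha : 0 < a) (hb : 0 < b) (hΩ : 0 < Ω) (j : ℤ) :
    toyPoint a b Ω j ≤ 0 ↔ (j : ℝ) ≤ 0 := by
  have hpos : 0 < π * √(toyP a b j) / √Ω := by
    have := toyP_pos ha hb j
    positivity
  rw [toyPoint, mul_right_comm, mul_div_right_comm, ← not_lt, mul_pos_iff_of_pos_left hpos, not_lt]

theorem toyP_toyPoint {a b : ℝ} (ha : 0 < a) (hb : 0 < b) (hΩ : 0 < Ω) (c d : ℝ) (j : ℤ) :
    toyP c d (toyPoint a b Ω j) = toyP c d j := by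
  simp only [toyP, toyPoint_nonpos_iff ha hb hΩ]

theorem travelTime_toyPoint (hα : 0 < α) (hβ : 0 < β) (hΩ : 0 < Ω) (j : ℤ) :
    travelTime α β (toyPoint (α ^ 4) (β ^ 4) Ω j) = π * j / √Ω := by
  rw [travelTime, toyP_toyPoint (pow_pos hα 4) (pow_pos hβ 4) hΩ, toyPoint, toyP, toyP]
  split_ifs
  · rw [sqrt_pow_four hα]
    field_simp
  · rw [sqrt_pow_four hβ]
    field_simp

theorem inv_toyWeight (hα : 0 < α) (hβ : 0 < β) (j : ℤ) :
    (toyWeight (α ^ 4) (β ^ 4) j)⁻¹ = (1 + 2 * toyP (-1) 1 j * (rotCos α β * rotSin α β) *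
      if j + j = 0 then 1 else 0) / toyP α β j ^ 2 := by
  rw [toyWeight, sqrt_pow_four hα, sqrt_pow_four hβ, rotCos_mul_rotSin hα hβ]
  rcases lt_trichotomy j 0 with hj | rfl | hj
  · simp [toyP, hj, hj.le, show ¬ j + j = 0 by omega]
  · simp only [toyP, Int.cast_zero, le_refl, if_true, add_zero, lt_irrefl, if_false]
    field_simp
    ring
  · simp [toyP, hj, hj.not_gt, hj.not_ge, show ¬ j + j = 0 by omega]

theorem toyKernel_toyPoint (hα : 0 < α) (hβ : 0 < β) (hΩ : 0 < Ω) (i j : ℤ) :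
    toyKernel (α ^ 4) (β ^ 4) Ω (toyPoint (α ^ 4) (β ^ 4) Ω i) (toyPoint (α ^ 4) (β ^ 4) Ω j) =
      if i = j then ((π * toyWeight (α ^ 4) (β ^ 4) j / √Ω : ℝ) : ℂ)⁻¹ else 0 := by
  have hΩ' : √Ω ≠ 0 := (Real.sqrt_pos.2 hΩ).ne'
  have hsub : √Ω * (π * i / √Ω - π * j / √Ω) = π * (i - j : ℤ) := by push_cast; field_simp
  have hadd : √Ω * (π * i / √Ω + π * j / √Ω) = π * (i + j : ℤ) := by push_cast; field_simp
  rw [toyKernel_eq hα hβ]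
  simp only [toyP_toyPoint (pow_pos hα 4) (pow_pos hβ 4) hΩ, travelTime_toyPoint hα hβ hΩ, hsub,
    hadd, sinc_pi_mul_intCast, sub_eq_zero]
  rcases eq_or_ne i j with rfl | hij
  · rw [if_pos rfl, if_pos rfl, ← Complex.ofReal_inv, inv_div, div_mul_eq_div_div √Ω,
      div_eq_mul_inv _ (toyWeight _ _ _), inv_toyWeight hα hβ]
    congr 1
    linear_combination √Ω / π / (toyP α β i * toyP α β i) *
      (rotCos_sq_add_rotSin_sq hα hβ + rotSin α β ^ 2 * sq_toyP_neg_one_one i)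
  · have hsign : (toyP (-1) 1 i + toyP (-1) 1 j) * (if i + j = 0 then 1 else 0) = 0 := by
      simp only [toyP, Int.cast_nonpos]
      split_ifs
      all_goals first | omega | norm_num
    rw [if_neg hij, if_neg hij, Complex.ofReal_eq_zero]
    linear_combination √Ω / π / (toyP α β i * toyP α β j) * (rotCos α β * rotSin α β) * hsign

theorem toyMap_toyPoint (hα : 0 < α) (hβ : 0 < β) (hΩ : 0 < Ω) (F : ℝ → ℂ) (j : ℤ) :
    toyMap α β F (toyPoint (α ^ 4) (β ^ 4) Ω j) = (toyP α β j : ℂ)⁻¹ *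
      (rotCos α β * F (π * j / √Ω) + rotSin α β * (toyP (-1) 1 j * F (-(π * j / √Ω)))) := by
  rw [toyMap, travelTime_toyPoint hα hβ hΩ, toyP_toyPoint (pow_pos hα 4) (pow_pos hβ 4) hΩ,
    toyP_toyPoint (pow_pos hα 4) (pow_pos hβ 4) hΩ]

theorem rotCos_ne_rotSin (hα : 0 < α) (hβ : 0 < β) : rotCos α β ≠ rotSin α β := by
  rw [rotCos, rotSin, Ne, div_left_inj' (by positivity)]
  linarith

theorem eq_zero_of_toyMap_toyPoint_eq_zero (hα : 0 < α) (hβ : 0 < β) (hΩ : 0 < Ω) {F : ℝ → ℂ}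
    (h0 : ∀ j : ℤ, toyMap α β F (toyPoint (α ^ 4) (β ^ 4) Ω j) = 0) (n : ℤ) :
    F (π * n / √Ω) = 0 := by
  have hrot : ∀ j : ℤ, rotCos α β * F (π * j / √Ω) +
      rotSin α β * (toyP (-1) 1 j * F (-(π * j / √Ω))) = 0 := fun j => by
    have hj := h0 j
    rw [toyMap_toyPoint hα hβ hΩ] at hj
    exact (mul_eq_zero.1 hj).resolve_left
      (inv_ne_zero (Complex.ofReal_ne_zero.2 (toyP_pos hα hβ j).ne'))
  rcases eq_or_ne n 0 with rfl | hn
  · have hzero := hrot 0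
    simp only [Int.cast_zero, mul_zero, zero_div, neg_zero, toyP, le_refl, if_true,
      Complex.ofReal_neg, Complex.ofReal_one, neg_one_mul, mul_neg, ← sub_eq_add_neg,
      ← sub_mul] at hzero ⊢
    exact (mul_eq_zero.1 hzero).resolve_left
      (sub_ne_zero.2 (Complex.ofReal_injective.ne (rotCos_ne_rotSin hα hβ)))
  · have hsign : (toyP (-1) 1 (n : ℝ) : ℂ) ^ 2 = 1 := by
      exact_mod_cast sq_toyP_neg_one_one n
    have hone : (rotCos α β : ℂ) ^ 2 + (rotSin α β : ℂ) ^ 2 = 1 := by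
      exact_mod_cast rotCos_sq_add_rotSin_sq hα hβ
    have hpos := hrot n
    have hneg := hrot (-n)
    rw [Int.cast_neg, toyP_neg_one_one_neg (Int.cast_ne_zero.2 hn), mul_neg, neg_div, neg_neg,
      Complex.ofReal_neg] at hneg
    linear_combination rotCos α β * hpos - rotSin α β * toyP (-1) 1 (n : ℝ) * hneg -
      F (π * n / √Ω) * (hone + rotSin α β ^ 2 * hsign)

theorem eq_zero_of_toyPoint_eq_zero (hα : 0 < α) (hβ : 0 < β) (hΩ : 0 < Ω) {u : ℝ → ℂ}
    (hu : u ∈ continuousElements (toyPaleyWiener α β Ω))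
    (h0 : ∀ j : ℤ, u (toyPoint (α ^ 4) (β ^ 4) Ω j) = 0) : u = 0 := by
  obtain ⟨φ, hφ, rfl⟩ := exists_isBandLimited_of_mem_continuousElements hα hβ hΩ hu
  have hlt : -(√Ω / (2 * π)) < √Ω / (2 * π) := neg_lt_self (by positivity)
  have hwidth : ∀ n : ℤ, n / (√Ω / (2 * π) - -(√Ω / (2 * π))) = π * n / √Ω := fun n => by
    field_simp
    ring
  have hzero : φ = 0 := eq_zero_of_fourierInv_intCast_div_eq_zero hlt hφ fun n => by
    rw [hwidth]
    exact eq_zero_of_toyMap_toyPoint_eq_zero hα hβ hΩ h0 n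
  ext x
  rw [← inner_toyKernelVec hφ, hzero, inner_zero_right, Pi.zero_apply]

theorem exists_pos_pow_four_eq {a : ℝ} (ha : 0 < a) : ∃ α : ℝ, 0 < α ∧ α ^ 4 = a := by
  refine ⟨√√a, by positivity, ?_⟩
  rw [show √√a ^ 4 = (√√a ^ 2) ^ 2 by ring, Real.sq_sqrt (by positivity), Real.sq_sqrt ha.le]

theorem ofReal_div_ofReal_mul_sum {ι : Type*} (p q : ℝ) (s : Finset ι) (w : ι → ℝ)
    (g h : ι → ℂ) : (p / q : ℂ) * ∑ j ∈ s, w j * g j * h j =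
      ∑ j ∈ s, ((p * w j / q : ℝ) : ℂ) * g j * h j := by
  rw [Finset.mul_sum]
  refine Finset.sum_congr rfl fun j _ => ?_
  push_cast
  ring

end SamplingPoints

theorem mainTheorem5 (pm pp Ω : ℝ) (hpm : 0 < pm) (hpp : 0 < pp) (hΩ : 0 < Ω) :
    -- `k` is the reproducing kernel of `PW_{[0,Ω]}(A_p)`
    IsReproducingKernel (paleyWiener (sturmLiouville (toyP pm pp)) (Icc 0 Ω))
      (toyKernel pm pp Ω) ∧
    -- the normalized kernels at the points `x_j` form an orthonormal basis
    (∃ b : HilbertBasis ℤ ℂ (paleyWiener (sturmLiouville (toyP pm pp)) (Icc 0 Ω)),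
      ∀ j : ℤ, ((b j : L2R) : ℝ → ℂ) =ᵐ[volume] fun y =>
        (√(Real.pi * toyWeight pm pp j / √Ω) : ℂ) *
          toyKernel pm pp Ω (toyPoint pm pp Ω j) y) ∧
    -- the cardinal series converges to `u` in `L²` and uniformly
    ∀ u ∈ continuousElements (paleyWiener (sturmLiouville (toyP pm pp)) (Icc 0 Ω)),
      Tendsto (fun s : Finset ℤ => eLpNorm (fun x => u x - (Real.pi / √Ω : ℂ) *
          ∑ j ∈ s, (toyWeight pm pp j : ℂ) * u (toyPoint pm pp Ω j) *
            toyKernel pm pp Ω (toyPoint pm pp Ω j) x) 2 volume) atTop (𝓝 0) ∧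
      TendstoUniformly (fun (s : Finset ℤ) (x : ℝ) => (Real.pi / √Ω : ℂ) *
          ∑ j ∈ s, (toyWeight pm pp j : ℂ) * u (toyPoint pm pp Ω j) *
            toyKernel pm pp Ω (toyPoint pm pp Ω j) x) u atTop := by
  obtain ⟨α, hα, rfl⟩ := exists_pos_pow_four_eq hpm
  obtain ⟨β, hβ, rfl⟩ := exists_pos_pow_four_eq hpp
  have hker := isReproducingKernel_toyKernel hα hβ hΩ
  have hcomplete : CompleteSpace (toyPaleyWiener α β Ω) :=
    (isClosed_paleyWiener _ _).completeSpace_coe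
  have hpos : ∀ j, 0 < Real.pi * toyWeight (α ^ 4) (β ^ 4) j / √Ω := fun j => by
    have := toyWeight_pos (pow_pos hα 4) (pow_pos hβ 4) j
    positivity
  have horth := toyKernel_toyPoint hα hβ hΩ
  have huniq := fun u hu => eq_zero_of_toyPoint_eq_zero hα hβ hΩ (u := u) hu
  refine ⟨hker, ⟨hker.samplingBasis hpos horth huniq, hker.coeFn_samplingBasis hpos horth huniq⟩,
    fun u hu => ?_⟩
  simp only [ofReal_div_ofReal_mul_sum]
  exact ⟨hker.tendsto_eLpNorm_sampling hpos horth huniq hu,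
    hker.tendstoUniformly_sampling hpos horth huniq hu (norm_toyKernel_self_le _ _)⟩
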